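/- All graphs are finite and simple; the graph without vertices is allowed. A tree decomposition of a graph $G$ is a pair $(T,\mathrm{bag})$, where $T$ is a finite tree with at least one node and $\mathrm{bag}$ assigns to each node of $T$ a subset of $V(G)$, such that every vertex of $G$ lies in some bag, both ends of every edge of $G$ lie in a common bag, and for every $v\in V(G)$ the set $\{t\in V(T) : v\in \mathrm{bag}(t)\}$ induces a connected subtree of $T$. Its width is $\max_{t\in V(T)}|\mathrm{bag}(t)|-1$. For $X,Y\subseteq V(G)$, the set $X$ is linked into $Y$ if the maximum number of pairwise vertex-disjoint paths in $G$ starting in $X$ and ending in $Y$ (single-vertex paths are allowed) equals $|X|$. A tree decomposition $(T,\mathrm{bag})$ of $G$ is lean if for any two (possibly equal) nodes $t_1,t_2\in V(T)$ and sets $Z_1\subseteq \mathrm{bag}(t_1)$, $Z_2\subseteq \mathrm{bag}(t_2)$ with $|Z_1|=|Z_2|$, either $Z_1$ is linked into $Z_2$, or the unique $t_1$–$t_2$ path in $T$ has an edge $xy$ with $|\mathrm{bag}(x)\cap \mathrm{bag}(y)|<|Z_1|$. For $X\subseteq V(G)$, let $\mathrm{torso}_G(X)$ be the graph with vertex set $X$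 in which distinct $u,v\in X$ are adjacent if $G$ has a path from $u$ to $v$ all of whose internal vertices (if any) lie in $V(G)\setminus X$. A torso tree decomposition in $G$ is a pair $(X,(T,\mathrm{bag}))$ with $X\subseteq V(G)$ and $(T,\mathrm{bag})$ a tree decomposition of $\mathrm{torso}_G(X)$; its width is the width of $(T,\mathrm{bag})$, and it covers $W\subseteq V(G)$ if $W\subseteq X$. A tree decomposition $(T,\mathrm{bag})$ of $G$ is strongly lean if it is lean and, for every node $t\in V(T)$, no torso tree decomposition in $G$ of width at most $|\mathrm{bag}(t)|-2$ covers $\mathrm{bag}(t)$. **Proposition.** Every graph $G$ admits a strongly lean tree decomposition. Moreover, every strongly lean tree decomposition of $G$ has width at most the width of every tree decomposition of $G$, that is, at most the treewidth of $G$. (Hence the proposition generalizes the theorem of Thomas that every graph has a lean tree decomposition of width at most its treewidth.) -/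

import Mathlib

namespace SimpleGraph

/-- A (finite) tree decomposition of `G`, with nodes `N`. -/
structure TreeDecomposition {V : Type*} (G : SimpleGraph V) (N : Type*) where
  /-- the tree of the decomposition -/
  tree : SimpleGraph N
  isTree : tree.IsTree
  /-- the bag of each node -/
  bag : N → Finset V
  vertex_condition : ∀ v : V, ∃ t : N, v ∈ bag t
  edge_condition : ∀ u v : V, G.Adj u v → ∃ t : N, u ∈ bag t ∧ v ∈ bag t
  connectedness_condition : ∀ v : V, (tree.induce {t : N | v ∈ bag t}).Connected

/-- The width, i.e. the maximum size of a bag, minus one. It is an integer, because the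
decomposition whose only bag is empty has width `-1`. -/
def TreeDecomposition.width {V N : Type*} [Fintype N] {G : SimpleGraph V}
    (D : G.TreeDecomposition N) : ℤ :=
  ((Finset.univ.sup fun t : N => (D.bag t).card : ℕ) : ℤ) - 1

/-- The torso of `X` in `G`: the graph on `X` in which two distinct vertices are adjacent if `G`
has a path between them all of whose internal vertices lie outside `X`. -/
def torso {V : Type*} (G : SimpleGraph V) (X : Finset V) : SimpleGraph X where
  Adj u v := u ≠ v ∧ ∃ p : G.Path (u : V) (v : V),
    ∀ w ∈ (p : G.Walk (u : V) (v : V)).support, w ≠ u → w ≠ v → w ∉ X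
  symm := by
    constructor
    rintro u v ⟨hne, p, hp⟩
    refine ⟨hne.symm, p.reverse, fun w hw hv hu => hp w ?_ hu hv⟩
    simpa using hw
  loopless := ⟨fun _ h => h.1 rfl⟩

/-- A torso tree decomposition in `G`: a set `X` of vertices together with a tree decomposition
of the torso of `X`. -/
structure TorsoTreeDecomposition {V : Type*} (G : SimpleGraph V) (N : Type*) where
  /-- the vertex set of the torso -/
  carrier : Finset V
  /-- the tree decomposition of the torso -/
  decomposition : (G.torso carrier).TreeDecomposition N

/-- The width of a torso tree decomposition. -/
def TorsoTreeDecomposition.width {V N : Type*} [Fintype N] {G : SimpleGraph V}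
    (E : G.TorsoTreeDecomposition N) : ℤ :=
  E.decomposition.width

/-- A torso tree decomposition covers `W` if `W` is contained in the vertex set of the torso. -/
def TorsoTreeDecomposition.Covers {V N : Type*} {G : SimpleGraph V}
    (E : G.TorsoTreeDecomposition N) (W : Finset V) : Prop :=
  W ⊆ E.carrier

/-- `G` contains `k` pairwise vertex-disjoint paths that start in `X` and end in `Y`. A path may
consist of a single vertex. -/
def HasDisjointPaths {V : Type*} (G : SimpleGraph V) (X Y : Finset V) (k : ℕ) : Prop :=
  ∃ (a b : Fin k → V) (p : ∀ i, G.Path (a i) (b i)),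
    (∀ i, a i ∈ X ∧ b i ∈ Y) ∧
    ∀ i j, i ≠ j → ∀ v, v ∈ (p i : G.Walk (a i) (b i)).support →
      v ∉ (p j : G.Walk (a j) (b j)).support

theorem HasDisjointPaths.le_card {V : Type*} {G : SimpleGraph V} {X Y : Finset V} {k : ℕ}
    (h : G.HasDisjointPaths X Y k) : k ≤ X.card := by
  obtain ⟨a, b, p, hab, hd⟩ := h
  have hinj : Function.Injective a := by
    intro i j hij
    by_contra hne
    refine hd i j hne (a i) (Walk.start_mem_support _) ?_
    rw [hij]
    exact Walk.start_mem_support _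
  simpa using Finset.card_le_card_of_injOn (s := Finset.univ) (t := X) a
    (fun i _ => (hab i).1) (fun i _ j _ hij => hinj hij)

/-- The maximum number of vertex-disjoint paths starting in `X` and ending in `Y`; the set is
bounded by `HasDisjointPaths.le_card`, and contains `0`. -/
noncomputable def flow {V : Type*} (G : SimpleGraph V) (X Y : Finset V) : ℕ :=
  sSup {k : ℕ | G.HasDisjointPaths X Y k}

/-- `X` is linked into `Y`. -/
def IsLinkedInto {V : Type*} (G : SimpleGraph V) (X Y : Finset V) : Prop :=
  G.flow X Y = X.card

/-- A tree decomposition is lean if for all nodes `t₁`, `t₂` and equally large subsets `Z₁`, `Z₂`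
of their bags, `Z₁` is linked into `Z₂` or the (unique) path between `t₁` and `t₂` in the tree has
an edge `xy` with `|bag x ∩ bag y| < |Z₁|`. -/
def TreeDecomposition.IsLeanDecomposition {V N : Type*} [DecidableEq V] {G : SimpleGraph V}
    (D : G.TreeDecomposition N) : Prop :=
  ∀ (t₁ t₂ : N) (Z₁ Z₂ : Finset V), Z₁ ⊆ D.bag t₁ → Z₂ ⊆ D.bag t₂ → Z₁.card = Z₂.card →
    G.IsLinkedInto Z₁ Z₂ ∨
      ∃ (p : D.tree.Path t₁ t₂) (x y : N), s(x, y) ∈ (p : D.tree.Walk t₁ t₂).edges ∧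
        (D.bag x ∩ D.bag y).card < Z₁.card

/-- A node `t` is strongly lean if no torso tree decomposition of width at most `|bag t| - 2`
covers the bag of `t`. (Every finite tree is isomorphic to one whose nodes form a type in
`Type`.) -/
def TreeDecomposition.IsStronglyLeanNode {V N : Type*} {G : SimpleGraph V}
    (D : G.TreeDecomposition N) (t : N) : Prop :=
  ¬ ∃ (M : Type) (_ : Fintype M) (E : G.TorsoTreeDecomposition M),
    E.Covers (D.bag t) ∧ E.width ≤ ((D.bag t).card : ℤ) - 2

/-- A tree decomposition is strongly lean if it is lean and all its nodes are strongly lean. -/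
def TreeDecomposition.IsStronglyLeanDecomposition {V N : Type*} [DecidableEq V] {G : SimpleGraph V}
    (D : G.TreeDecomposition N) : Prop :=
  D.IsLeanDecomposition ∧ ∀ t : N, D.IsStronglyLeanNode t

end SimpleGraph

/-! Take a tree decomposition `D` of `G` whose numbers of bags of each size, compared from the
largest size downwards, are least. If `D` is not strongly lean, a decomposition with smaller profile
can be built.

A violation yields a set `X` and a decomposition `E` of its torso with all bags smaller than some
`k`. If leanness fails, `X` is a separator with fewer than `k` vertices, taken as a single bag; if a
bag of size `k` is covered too cheaply, `E` is the cover. For each part of the complement of `X`, a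
copy of `D`, cut down to the part and its border, is attached to `E`. Border vertices are added to
the bags on the way to the root of the copy, so that they reach the attaching edge (`Gluing`).

The point is that no copy of a bag exceeds the original. If at some node the added vertices of the
border are exchanged for the removed ones, the border remains a separator
(`Gluing.separates_exchange`). Since `X` has minimum weight, that is, minimum size and then minimum
sum of distances to the root (to both ends of the path in the case of leanness), at least as many
vertices are removed as added, and equality forces that none are: removed vertices are nearer to the
root, or else there is a shorter violation of leanness. For covers, the required minimality of
borders comes from contracting one side of a separator along a Menger linkage (`exists_of_linkage`).
Hence a bag of size at least `k` has at most one copy of its own size, and some such bag has only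
smaller copies, so the profile drops (`Gluing.profile_lt`).

For the bound on the width, a tree decomposition of `G` is a torso tree decomposition with `X = V`,
which covers a largest bag of `D`. -/

namespace SimpleGraph

/-! ### Walks inside a set, and paths in trees -/

/-- `u` and `v` are joined by a walk all of whose vertices lie in `A`. -/
def JoinIn {V : Type*} (G : SimpleGraph V) (A : Set V) (u v : V) : Prop :=
  ∃ p : G.Walk u v, ∀ w ∈ p.support, w ∈ A

namespace JoinIn

variable {V : Type*} {G : SimpleGraph V} {A B : Set V} {u v w : V}

protected theorem refl (h : u ∈ A) : G.JoinIn A u u := ⟨.nil, by simpa using h⟩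

protected theorem symm (h : G.JoinIn A u v) : G.JoinIn A v u := by
  obtain ⟨p, hp⟩ := h
  exact ⟨p.reverse, by simpa using hp⟩

protected theorem trans (h : G.JoinIn A u v) (h' : G.JoinIn A v w) : G.JoinIn A u w := by
  obtain ⟨p, hp⟩ := h
  obtain ⟨q, hq⟩ := h'
  refine ⟨p.append q, fun x hx => ?_⟩
  rcases (Walk.mem_support_append_iff p q).1 hx with h | h
  exacts [hp x h, hq x h]

theorem mono (h : G.JoinIn A u v) (hAB : A ⊆ B) : G.JoinIn B u v := by
  obtain ⟨p, hp⟩ := h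
  exact ⟨p, fun x hx => hAB (hp x hx)⟩

theorem left_mem (h : G.JoinIn A u v) : u ∈ A := by
  obtain ⟨p, hp⟩ := h
  exact hp _ p.start_mem_support

theorem right_mem (h : G.JoinIn A u v) : v ∈ A := by
  obtain ⟨p, hp⟩ := h
  exact hp _ p.end_mem_support

theorem of_adj (h : G.Adj u v) (hu : u ∈ A) (hv : v ∈ A) : G.JoinIn A u v :=
  ⟨.cons h .nil, by simp [hu, hv]⟩

theorem of_walk (p : G.Walk u v) (hp : ∀ x ∈ p.support, x ∈ A) (hw : w ∈ p.support) :
    G.JoinIn A u w := by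
  classical
  exact ⟨p.takeUntil w hw, fun x hx => hp x (p.support_takeUntil_subset_support hw hx)⟩

theorem of_walk' (p : G.Walk u v) (hp : ∀ x ∈ p.support, x ∈ A) (hw : w ∈ p.support) :
    G.JoinIn A w v := by
  classical
  exact ⟨p.dropUntil w hw, fun x hx => hp x (p.support_dropUntil_subset_support hw hx)⟩

/-- A joining walk that cannot avoid `S` joins its start to a vertex of `S`. -/
theorem exists_mem (h : G.JoinIn A u v) {S : Set V} (hS : ¬ G.JoinIn Sᶜ u v) :
    ∃ s ∈ S, G.JoinIn A u s := by
  obtain ⟨p, hp⟩ := h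
  by_contra! hc
  exact hS ⟨p, fun w hw hws => hc w hws (of_walk p hp hw)⟩

theorem mem_of_closed (h : G.JoinIn A u v) {C : Set V} (hu : u ∈ C)
    (hC : ∀ x ∈ C, ∀ y ∈ A, G.Adj x y → y ∈ C) : v ∈ C := by
  obtain ⟨p, hp⟩ := h
  induction p with
  | nil => exact hu
  | cons hadj q ih =>
    simp only [Walk.support_cons, List.mem_cons, forall_eq_or_imp] at hp
    exact ih (hC _ hu _ (hp.2 _ q.start_mem_support) hadj) hp.2

end JoinIn

theorem Walk.forall_mem_of_closed {V : Type*} {G : SimpleGraph V} {u v : V} (p : G.Walk u v)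
    {C : Set V} (hu : u ∈ C) (hC : ∀ x ∈ C, ∀ y ∈ p.support, G.Adj x y → y ∈ C) :
    ∀ w ∈ p.support, w ∈ C := fun _ hw =>
  (JoinIn.of_walk (A := {x | x ∈ p.support}) p (fun _ h => h) hw).mem_of_closed hu hC

/-- The final segment of a walk from its last vertex in `S`. -/
theorem Walk.exists_last {V : Type*} {G : SimpleGraph V} {u v : V} (p : G.Walk u v) (S : Set V)
    (h : ∃ x ∈ p.support, x ∈ S) :
    ∃ x ∈ p.support, x ∈ S ∧ ∃ q : G.Walk x v, (∀ w ∈ q.support, w ∈ p.support) ∧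
      ∀ w ∈ q.support, w ∈ S → w = x := by
  induction p with
  | nil =>
    obtain ⟨x, hx, hxS⟩ := h
    simp only [Walk.support_nil, List.mem_singleton] at hx
    subst hx
    exact ⟨x, by simp, hxS, .nil, by simp⟩
  | @cons a b c hadj q ih =>
    by_cases hq : ∃ x ∈ q.support, x ∈ S
    · obtain ⟨x, hx, hxS, r, hr, hr'⟩ := ih hq
      exact ⟨x, by simp [hx], hxS, r, fun w hw => by simp [hr w hw], hr'⟩
    · obtain ⟨x, hx, hxS⟩ := h
      push Not at hq
      simp only [Walk.support_cons, List.mem_cons] at hx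
      have hxa : x = a := hx.resolve_right fun h => hq x h hxS
      subst hxa
      refine ⟨x, by simp, hxS, .cons hadj q, fun _ h => h, fun w hw hwS => ?_⟩
      simp only [Walk.support_cons, List.mem_cons] at hw
      exact hw.resolve_right fun h => hq w h hwS

/-- Every vertex on a path of a tree lies in every set in which its ends are joined. -/
theorem IsTree.mem_of_joinIn {N : Type*} {T : SimpleGraph N} (hT : T.IsTree) {s t x : N}
    {p : T.Walk s t} (hp : p.IsPath) (hx : x ∈ p.support) {A : Set N} (h : T.JoinIn A s t) :
    x ∈ A := by
  classical
  obtain ⟨q, hq⟩ := h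
  have : p = q.bypass := (hT.existsUnique_path s t).unique hp q.bypass_isPath
  exact hq x (q.support_bypass_subset_support (this ▸ hx))

/-- Translates the connectedness of induced subtrees into walks of the ambient tree, which avoids
subtypes from here on. -/
theorem connected_induce_iff_joinIn {V : Type*} {G : SimpleGraph V} {A : Set V} :
    (G.induce A).Connected ↔ A.Nonempty ∧ ∀ u ∈ A, ∀ v ∈ A, G.JoinIn A u v := by
  constructor
  · intro h
    refine ⟨Set.nonempty_coe_sort.1 h.nonempty, fun u hu v hv => ?_⟩
    have key : ∀ a b : A, (G.induce A).Reachable a b → G.JoinIn A a b := by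
      rintro a b ⟨p⟩
      induction p with
      | nil => exact .refl (Subtype.coe_prop _)
      | cons hadj _ ih =>
        exact (JoinIn.of_adj (comap_adj.1 hadj) (Subtype.coe_prop _) (Subtype.coe_prop _)).trans ih
    exact key ⟨u, hu⟩ ⟨v, hv⟩ (h.preconnected _ _)
  · rintro ⟨⟨a, ha⟩, h⟩
    have : Nonempty A := ⟨⟨a, ha⟩⟩
    refine ⟨fun u v => ?_⟩
    obtain ⟨p, hp⟩ := h u u.2 v v.2
    exact ⟨p.induce A hp⟩

/-! ### Separators and Menger's theorem -/

/-- Every walk from `A` to `B` meets `S`. -/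
def Separates {V : Type*} (G : SimpleGraph V) (A B S : Finset V) : Prop :=
  ∀ a ∈ A, ∀ b ∈ B, ¬ G.JoinIn (S : Set V)ᶜ a b

theorem Separates.symm {V : Type*} {G : SimpleGraph V} {A B S : Finset V}
    (h : G.Separates A B S) : G.Separates B A S :=
  fun a ha b hb hab => h b hb a ha hab.symm

/-- A family of pairwise disjoint paths that start in `A` and end in the respective vertices
of `T`. -/
def Linkage {V : Type*} (G : SimpleGraph V) (A T : Finset V) : Prop :=
  ∃ (a : V → V) (p : ∀ t, G.Walk (a t) t), (∀ t ∈ T, a t ∈ A) ∧ (∀ t, (p t).IsPath) ∧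
    ∀ t ∈ T, ∀ t' ∈ T, ∀ v ∈ (p t).support, v ∈ (p t').support → t = t'

/-- A family of pairwise disjoint walks from `A` to `B`, indexed by a finite set of size `k`. -/
def DisjointWalks {V : Type*} (G : SimpleGraph V) (A B : Finset V) (k : ℕ) : Prop :=
  ∃ (J : Finset V) (a b : V → V) (p : ∀ j, G.Walk (a j) (b j)), J.card = k ∧
    (∀ j ∈ J, a j ∈ A ∧ b j ∈ B) ∧
    ∀ i ∈ J, ∀ j ∈ J, ∀ v ∈ (p i).support, v ∈ (p j).support → i = j

theorem DisjointWalks.hasDisjointPaths {V : Type*} {G : SimpleGraph V} {A B : Finset V} {k : ℕ}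
    (h : G.DisjointWalks A B k) : G.HasDisjointPaths A B k := by
  classical
  obtain ⟨J, a, b, p, hJ, hab, hd⟩ := h
  let e := J.equivFinOfCardEq hJ
  refine ⟨fun i => a (e.symm i), fun i => b (e.symm i), fun i => (p (e.symm i)).toPath,
    fun i => hab _ (e.symm i).2, fun i j hij v hv hv' => hij ?_⟩
  have := hd _ (e.symm i).2 _ (e.symm j).2 v ((p _).support_bypass_subset_support hv)
    ((p _).support_bypass_subset_support hv')
  exact e.symm.injective (Subtype.ext this)

/-- Disjoint walks have distinct ends, so `B.card` of them use up all of `B` and can be indexed by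
their ends. Outside `B` trivial walks serve as default values. -/
theorem DisjointWalks.linkage {V : Type*} {G : SimpleGraph V} {A B : Finset V}
    (h : G.DisjointWalks A B B.card) : G.Linkage A B := by
  classical
  obtain ⟨J, a, b, p, hJ, hab, hd⟩ := h
  have hinj : Set.InjOn b J := fun i hi j hj hij =>
    hd i hi j hj (b i) (p i).end_mem_support (by rw [hij]; exact (p j).end_mem_support)
  have himg : J.image b = B := Finset.eq_of_subset_of_card_le
    (Finset.image_subset_iff.2 fun j hj => (hab j hj).2)
    (by rw [Finset.card_image_of_injOn hinj, hJ])
  have key : ∀ t, ∃ (x : V) (q : G.Walk x t), q.IsPath ∧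
      (t ∈ B → ∃ j ∈ J, b j = t ∧ x ∈ A ∧ ∀ w ∈ q.support, w ∈ (p j).support) := by
    intro t
    by_cases ht : t ∈ B
    · rw [← himg, Finset.mem_image] at ht
      obtain ⟨j, hj, rfl⟩ := ht
      exact ⟨a j, (p j).bypass, (p j).bypass_isPath, fun _ => ⟨j, hj, rfl, (hab j hj).1,
        fun w hw => (p j).support_bypass_subset_support hw⟩⟩
    · exact ⟨t, .nil, .nil, fun h => absurd h ht⟩
  choose x q hq hxq using key
  refine ⟨x, q, fun t ht => (hxq t ht).choose_spec.2.2.1, hq, fun t ht t' ht' v hv hv' => ?_⟩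
  obtain ⟨j, hj, rfl, -, h1⟩ := hxq t ht
  obtain ⟨j', hj', rfl, -, h2⟩ := hxq t' ht'
  rw [hd j hj j' hj' v (h1 v hv) (h2 v hv')]

/-- How a walk of `G` may use a fixed edge `xy`. -/
theorem JoinIn.of_deleteEdges {V : Type*} {G : SimpleGraph V} {x y : V} {U : Set V}
    {a b : V} (h : G.JoinIn U a b) :
    (G.deleteEdges {s(x, y)}).JoinIn U a b ∨
    ((G.deleteEdges {s(x, y)}).JoinIn U a x ∧ (G.deleteEdges {s(x, y)}).JoinIn U y b) ∨
    ((G.deleteEdges {s(x, y)}).JoinIn U a y ∧ (G.deleteEdges {s(x, y)}).JoinIn U x b) := by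
  obtain ⟨p, hp⟩ := h
  induction p with
  | nil => exact Or.inl (.refl (hp _ (by simp)))
  | @cons a c b hadj q ih =>
    simp only [Walk.support_cons, List.mem_cons, forall_eq_or_imp] at hp
    have hc := hp.2 _ q.start_mem_support
    have ih := ih hp.2
    by_cases he : s(a, c) = s(x, y)
    · rw [Sym2.eq_iff] at he
      rcases he with ⟨rfl, rfl⟩ | ⟨rfl, rfl⟩
      · rcases ih with h | ⟨-, h⟩ | ⟨-, h⟩
        · exact Or.inr (Or.inl ⟨.refl hp.1, h⟩)
        · exact Or.inr (Or.inl ⟨.refl hp.1, h⟩)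
        · exact Or.inl h
      · rcases ih with h | ⟨-, h⟩ | ⟨-, h⟩
        · exact Or.inr (Or.inr ⟨.refl hp.1, h⟩)
        · exact Or.inl h
        · exact Or.inr (Or.inr ⟨.refl hp.1, h⟩)
    · have hac : (G.deleteEdges {s(x, y)}).JoinIn U a c :=
        .of_adj (by simpa [deleteEdges_adj, hadj] using he) hp.1 hc
      rcases ih with h | ⟨h, h'⟩ | ⟨h, h'⟩
      · exact Or.inl (hac.trans h)
      · exact Or.inr (Or.inl ⟨hac.trans h, h'⟩)
      · exact Or.inr (Or.inr ⟨hac.trans h, h'⟩)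

/-- The set version of Menger's theorem; the proof is Göring's. -/
theorem disjointWalks_of_forall_separates {V : Type*} [Finite V] (k : ℕ) (G : SimpleGraph V)
    (A B : Finset V) (h : ∀ S : Finset V, G.Separates A B S → k ≤ S.card) :
    G.DisjointWalks A B k := by
  classical
  induction G using WellFoundedLT.induction generalizing A B with
  | ind G ih =>
  by_cases hG : ∃ x y, G.Adj x y
  swap
  · push Not at hG
    obtain ⟨J, hJ, hJk⟩ := Finset.exists_subset_card_eq (h (A ∩ B) (by
      rintro a ha b hb ⟨p, hp⟩
      cases p with
      | nil => exact hp a (by simp) (by simp [ha, hb])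
      | cons hadj => exact hG _ _ hadj))
    refine ⟨J, id, id, fun j => .nil, hJk, fun j hj => Finset.mem_inter.1 (hJ hj), ?_⟩
    rintro i - j - v hv hv'
    simp only [id, Walk.support_nil, List.mem_singleton] at hv hv'
    exact hv.symm.trans hv'
  obtain ⟨x, y, hxy⟩ := hG
  have hlt : ∀ {x y : V}, G.Adj x y → G.deleteEdges {s(x, y)} < G := fun {x y} hxy =>
    lt_of_le_of_ne (deleteEdges_le _) fun he => by
      have : (G.deleteEdges {s(x, y)}).Adj x y := by rw [he]; exact hxy
      simp [deleteEdges_adj] at this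
  by_cases hS : ∀ S, (G.deleteEdges {s(x, y)}).Separates A B S → k ≤ S.card
  · obtain ⟨J, a, b, p, hJ, hab, hd⟩ := ih _ (hlt hxy) A B hS
    exact ⟨J, a, b, fun j => (p j).mapLe (deleteEdges_le _), hJ, hab, by simpa using hd⟩
  push Not at hS
  obtain ⟨S, hS, hSk⟩ := hS
  have hnS : ¬ G.Separates A B S := fun h' => absurd (h S h') (by omega)
  -- orient the edge in the direction in which it is used
  have hor : ∃ x y, G.Adj x y ∧ (G.deleteEdges {s(x, y)}).Separates A B S ∧
      (∃ a ∈ A, (G.deleteEdges {s(x, y)}).JoinIn (S : Set V)ᶜ a x) ∧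
      ∃ b ∈ B, (G.deleteEdges {s(x, y)}).JoinIn (S : Set V)ᶜ y b := by
    unfold Separates at hnS
    push Not at hnS
    obtain ⟨a, ha, b, hb, hab⟩ := hnS
    rcases hab.of_deleteEdges (x := x) (y := y) with h' | ⟨h1, h2⟩ | ⟨h1, h2⟩
    · exact absurd h' (hS a ha b hb)
    · exact ⟨x, y, hxy, hS, ⟨a, ha, h1⟩, b, hb, h2⟩
    · refine ⟨y, x, hxy.symm, ?_, ?_, ?_⟩ <;> rw [Sym2.eq_swap]
      exacts [hS, ⟨a, ha, h1⟩, ⟨b, hb, h2⟩]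
  clear hxy hS hnS x y
  obtain ⟨x, y, hxy, hS, ⟨a₀, ha₀, hax⟩, b₀, hb₀, hyb⟩ := hor
  have hlt := hlt hxy
  set G' := G.deleteEdges {s(x, y)} with hG'
  have hAy : ∀ a ∈ A, ¬ G'.JoinIn (S : Set V)ᶜ a y := fun a ha h' =>
    hS a ha b₀ hb₀ (h'.trans hyb)
  have hxB : ∀ b ∈ B, ¬ G'.JoinIn (S : Set V)ᶜ b x := fun b hb h' =>
    hS a₀ ha₀ b hb (hax.trans h'.symm)
  have hmono : ∀ z, ((insert z S : Finset V) : Set V)ᶜ ⊆ (S : Set V)ᶜ := fun z =>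
    Set.compl_subset_compl.2 (by simp)
  have hSx : G.Separates A B (insert x S) := by
    intro a ha b hb hab
    rcases hab.of_deleteEdges (x := x) (y := y) with h' | ⟨h1, -⟩ | ⟨-, h1⟩
    · exact hS a ha b hb (h'.mono (hmono x))
    · exact h1.right_mem (by simp)
    · exact h1.left_mem (by simp)
  have hSy : G.Separates A B (insert y S) := by
    intro a ha b hb hab
    rcases hab.of_deleteEdges (x := x) (y := y) with h' | ⟨-, h1⟩ | ⟨h1, -⟩
    · exact hS a ha b hb (h'.mono (hmono y))
    · exact h1.left_mem (by simp)
    · exact h1.right_mem (by simp)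
  have hcx := h _ hSx
  have hcy := h _ hSy
  have hcx' := Finset.card_insert_le x S
  have hcy' := Finset.card_insert_le y S
  have hyS : y ∉ S := fun hy => by rw [Finset.insert_eq_of_mem hy] at hcy; omega
  -- A separator of `A` and `S + x` in `G'` separates `A` from `B` in `G`: each walk from `A` to `B`
  -- either meets `S` before using the edge `xy`, or reaches `x`, or stays in `G'` and so meets `S`.
  have hP := (ih G' hlt A (insert x S) fun Z hZ => by
    refine le_trans (le_trans (by omega) hcx) (le_trans ?_ (h Z ?_))
    · omega
    intro a ha b hb hab
    rcases hab.of_deleteEdges (x := x) (y := y) with h' | ⟨h1, -⟩ | ⟨h1, -⟩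
    · obtain ⟨s, hs, h'⟩ := h'.exists_mem (hS a ha b hb)
      exact hZ a ha s (Finset.mem_insert_of_mem hs) h'
    · exact hZ a ha x (Finset.mem_insert_self _ _) h1
    · obtain ⟨s, hs, h'⟩ := h1.exists_mem (hAy a ha)
      exact hZ a ha s (Finset.mem_insert_of_mem hs) h')
  have hQ := (ih G' hlt B (insert y S) fun Z hZ => by
    refine le_trans (le_trans (by omega) hcy) (le_trans ?_ (h Z ?_))
    · omega
    intro a ha b hb hab
    rcases hab.of_deleteEdges (x := x) (y := y) with h' | ⟨-, h1⟩ | ⟨-, h1⟩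
    · obtain ⟨s, hs, h'⟩ := h'.symm.exists_mem (hS.symm b hb a ha)
      exact hZ b hb s (Finset.mem_insert_of_mem hs) h'
    · exact hZ b hb y (Finset.mem_insert_self _ _) h1.symm
    · obtain ⟨s, hs, h'⟩ := h1.symm.exists_mem (hxB b hb)
      exact hZ b hb s (Finset.mem_insert_of_mem hs) h')
  have hcardx : (insert x S).card = k := by omega
  have hcardy : (insert y S).card = k := by omega
  rw [← hcardx] at hP
  rw [← hcardy] at hQ
  obtain ⟨a, p, haA, hp, hpd⟩ := hP.linkage
  obtain ⟨b, q, hbB, hq, hqd⟩ := hQ.linkage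
  -- Switching at a common vertex from one family to the other gives a walk of `G'` from `A` to `B`.
  -- It must meet `S`, which is possible only if the common vertex is the end of both paths.
  have hmeet : ∀ s ∈ insert x S, ∀ t ∈ insert y S, ∀ v ∈ (p s).support, v ∈ (q t).support →
      s = t ∧ s ∈ S := by
    intro s hs t ht v hvp hvq
    by_contra hc
    refine hS (a s) (haA s hs) (b t) (hbB t ht)
      ⟨((p s).takeUntil v hvp).append ((q t).takeUntil v hvq).reverse, fun z hz hzS => hc ?_⟩
    have hzS : z ∈ S := hzS
    have hzx : z ∈ insert x S := Finset.mem_insert_of_mem hzS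
    have hzy : z ∈ insert y S := Finset.mem_insert_of_mem hzS
    rw [Walk.mem_support_append_iff, Walk.support_reverse, List.mem_reverse] at hz
    rcases hz with hz | hz
    · have hzs : s = z := hpd s hs z hzx z
        ((p s).support_takeUntil_subset_support hvp hz) (p z).end_mem_support
      subst hzs
      have hv : v = s := by
        by_contra hne
        exact Walk.endpoint_notMem_support_takeUntil (hp s) hvp (Ne.symm hne) hz
      subst hv
      exact ⟨hqd v hzy t ht v (q v).end_mem_support hvq, hzS⟩
    · have hzs : t = z := hqd t ht z hzy z
        ((q t).support_takeUntil_subset_support hvq hz) (q z).end_mem_support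
      subst hzs
      have hv : v = t := by
        by_contra hne
        exact Walk.endpoint_notMem_support_takeUntil (hq t) hvq (Ne.symm hne) hz
      subst hv
      have := hpd v hzx s hs v (p v).end_mem_support hvp
      exact ⟨this.symm, this ▸ hzS⟩
  -- The two paths ending in the same vertex of `S` are joined there; the one ending in `x`
  -- continues along the edge `xy`.
  let σ : V → V := fun s => if s ∈ S then s else y
  have hσ : ∀ s, σ s ∈ insert y S := fun s => by
    by_cases hs : s ∈ S <;> simp [σ, hs]
  have key : ∀ s, ∃ (c : V) (r : G.Walk (a s) c), s ∈ insert x S → c ∈ B ∧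
      ∀ v ∈ r.support, v ∈ (p s).support ∨ v ∈ (q (σ s)).support := by
    intro s
    by_cases hs : s ∈ S
    · have hσs : σ s = s := by simp [σ, hs]
      refine ⟨b s, ((p s).append (q s).reverse).mapLe (deleteEdges_le _), fun _ =>
        ⟨hbB s (Finset.mem_insert_of_mem hs), fun v hv => ?_⟩⟩
      rw [hσs]
      simpa [Walk.mem_support_append_iff] using hv
    · by_cases hsx : s = x
      · subst hsx
        have hσs : σ s = y := by simp [σ, hs]
        refine ⟨b y, ((p s).mapLe (deleteEdges_le _)).append
          (.cons hxy ((q y).reverse.mapLe (deleteEdges_le _))), fun _ =>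
          ⟨hbB y (Finset.mem_insert_self _ _), fun v hv => ?_⟩⟩
        simp only [Walk.mem_support_append_iff, Walk.support_mapLe_eq_support, Walk.support_cons,
          List.mem_cons, Walk.support_reverse, List.mem_reverse] at hv
        rw [hσs]
        rcases hv with hv | rfl | hv
        exacts [Or.inl hv, Or.inl (p v).end_mem_support, Or.inr hv]
      · exact ⟨_, .nil, fun h => by simp [hs, hsx] at h⟩
  choose c r hr using key
  have hσinj : ∀ s ∈ insert x S, ∀ t ∈ insert x S, σ s = σ t → s = t := by
    intro s hs t ht hst
    simp only [Finset.mem_insert] at hs ht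
    by_cases h1 : s ∈ S <;> by_cases h2 : t ∈ S <;> simp only [σ, h1, h2, if_true, if_false] at hst
    · exact hst
    · exact absurd (hst ▸ h1) hyS
    · exact absurd (hst ▸ h2) hyS
    · rw [hs.resolve_right h1, ht.resolve_right h2]
  have hcross : ∀ s ∈ insert x S, ∀ t ∈ insert x S, ∀ v ∈ (p s).support,
      v ∈ (q (σ t)).support → s = t := by
    intro s hs t ht v h1 h2
    obtain ⟨h3, h4⟩ := hmeet s hs _ (hσ t) v h1 h2
    exact hσinj s hs t ht (by simpa [σ, h4] using h3)
  refine ⟨insert x S, a, c, r, hcardx, fun s hs => ⟨haA s hs, (hr s hs).1⟩,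
    fun s hs t ht v hv hv' => ?_⟩
  rcases (hr s hs).2 v hv with h1 | h1 <;> rcases (hr t ht).2 v hv' with h2 | h2
  · exact hpd s hs t ht v h1 h2
  · exact hcross s hs t ht v h1 h2
  · exact (hcross t ht s hs v h2 h1).symm
  · exact hσinj s hs t ht (hqd _ (hσ s) _ (hσ t) v h1 h2)

theorem isLinkedInto_of_forall_separates {V : Type*} [Finite V] {G : SimpleGraph V}
    {A B : Finset V} (h : ∀ S : Finset V, G.Separates A B S → A.card ≤ S.card) :
    G.IsLinkedInto A B := by
  have h1 := (disjointWalks_of_forall_separates _ G A B h).hasDisjointPaths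
  refine le_antisymm (csSup_le ⟨_, h1⟩ fun k hk => hk.le_card) ?_
  exact le_csSup ⟨A.card, fun k hk => HasDisjointPaths.le_card hk⟩ h1


/-! ### Decompositions of torsos -/

/-- If `x` is the only vertex of `A` on a path from `x` to `t`, then this path lies in every set
in which `t` is joined to a vertex of `A`. -/
theorem IsTree.gate_mem {N : Type*} {T : SimpleGraph N} (hT : T.IsTree) {A B : Set N}
    {x y z t : N} {q : T.Walk x t} (hq : q.IsPath) (hqA : ∀ w ∈ q.support, w ∈ A → w = x)
    (hzx : T.JoinIn A z x) (h : T.JoinIn B z t) (hy : y ∈ q.support) : y ∈ B := by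
  classical
  obtain ⟨r, hr⟩ := hzx
  have hp : (r.bypass.append q).IsPath := by
    rw [Walk.isPath_def, Walk.support_append, List.nodup_append']
    refine ⟨r.bypass_isPath.support_nodup, hq.support_nodup.tail, ?_⟩
    intro w hw hw'
    have h1 := hr w (r.support_bypass_subset_support hw)
    have h2 := hqA w (List.mem_of_mem_tail hw') h1
    subst h2
    have := hq.support_nodup
    rw [← Walk.cons_tail_support, List.nodup_cons] at this
    exact this.1 hw'
  exact hT.mem_of_joinIn hp (by simp [hy]) h

/-- A path from a nonempty set to a given node that leaves the set at once. -/
theorem Connected.exists_gate {N : Type*} {T : SimpleGraph N} (hT : T.Connected) {A : Set N}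
    {s : N} (hs : s ∈ A) (t : N) :
    ∃ x ∈ A, ∃ q : T.Walk x t, q.IsPath ∧ ∀ w ∈ q.support, w ∈ A → w = x := by
  classical
  obtain ⟨p⟩ := hT.preconnected s t
  obtain ⟨x, -, hx, q, -, hq⟩ := p.exists_last A ⟨s, p.start_mem_support, hs⟩
  exact ⟨x, hx, q.bypass, q.bypass_isPath, fun w hw =>
    hq w (q.support_bypass_subset_support hw)⟩

/-- A tree decomposition of the torso of `X` in `G`, with bags regarded as sets of vertices
of `G`. -/
structure PartialDecomposition {V : Type*} (G : SimpleGraph V) (X : Finset V) (M : Type*) where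
  /-- the tree of the decomposition -/
  tree : SimpleGraph M
  isTree : tree.IsTree
  /-- the bag of each node -/
  bag : M → Finset V
  bag_subset : ∀ m, bag m ⊆ X
  joinIn : ∀ v m m', v ∈ bag m → v ∈ bag m' → tree.JoinIn {n | v ∈ bag n} m m'
  torso : ∀ u ∈ X, ∀ v ∈ X, ∀ p : G.Walk u v, (∀ w ∈ p.support, w ∈ X → w = u ∨ w = v) →
    ∃ m, u ∈ bag m ∧ v ∈ bag m

namespace PartialDecomposition

variable {V M : Type*} {G : SimpleGraph V} {X : Finset V}

/-- The condition `torso` allows `u = v`; with the trivial walk it contains the vertex condition. -/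
theorem exists_mem_bag (E : G.PartialDecomposition X M) {v : V} (hv : v ∈ X) :
    ∃ m, v ∈ E.bag m := by
  obtain ⟨m, hm, -⟩ := E.torso v hv v hv .nil (by simp)
  exact ⟨m, hm⟩

/-- The nodes whose bags meet a given walk of `G` are joined in the tree. -/
theorem joinIn_of_walk (E : G.PartialDecomposition X M) {u v : V} (p : G.Walk u v) (hu : u ∈ X)
    (hv : v ∈ X) {m m' : M} (hm : u ∈ E.bag m) (hm' : v ∈ E.bag m') :
    E.tree.JoinIn {n | ∃ w ∈ p.support, w ∈ E.bag n} m m' := by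
  classical
  induction hn : p.length using Nat.strong_induction_on generalizing u v m m' with
  | h k ih =>
  subst hn
  by_cases h : ∀ w ∈ p.support, w ∈ X → w = u ∨ w = v
  · obtain ⟨n, hn, hn'⟩ := E.torso u hu v hv p h
    refine ((E.joinIn u m n hm hn).mono ?_).trans ((E.joinIn v n m' hn' hm').mono ?_)
    · exact fun x hx => ⟨u, p.start_mem_support, hx⟩
    · exact fun x hx => ⟨v, p.end_mem_support, hx⟩
  · push Not at h
    obtain ⟨w, hw, hwX, hwu, hwv⟩ := h
    obtain ⟨n, hn⟩ := E.exists_mem_bag hwX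
    refine ((ih _ (p.length_takeUntil_lt_length hw hwv) (p.takeUntil w hw) hu hwX hm hn
      rfl).mono ?_).trans ((ih _ (p.length_dropUntil_lt_length hw hwu) (p.dropUntil w hw) hwX hv
        hn hm' rfl).mono ?_)
    · rintro x ⟨y, hy, hyx⟩
      exact ⟨y, p.support_takeUntil_subset_support hw hy, hyx⟩
    · rintro x ⟨y, hy, hyx⟩
      exact ⟨y, p.support_dropUntil_subset_support hw hy, hyx⟩

/-- The Helly property of the subtrees of a tree, for tree decompositions. -/
theorem exists_subset_bag [Finite M] (E : G.PartialDecomposition X M) (K : Finset V)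
    (hK : ∀ u ∈ K, ∀ v ∈ K, ∃ m, u ∈ E.bag m ∧ v ∈ E.bag m) : ∃ m, K ⊆ E.bag m := by
  classical
  have : Nonempty M := E.isTree.connected.nonempty
  obtain ⟨t, ht⟩ := Finite.exists_max fun m => (K ∩ E.bag m).card
  refine ⟨t, fun v hv => ?_⟩
  by_contra hvt
  obtain ⟨s, hs, -⟩ := hK v hv v hv
  -- The bag at the gate `x` of the subtree of `v` contains `v` and all of `K ∩ E.bag t`, because
  -- the subtree of each `u` in that set meets that of `v` and contains `t`. This contradicts the
  -- choice of `t`.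
  obtain ⟨x, hx, q, hqp, hq⟩ := E.isTree.connected.exists_gate (A := {n | v ∈ E.bag n}) hs t
  refine absurd (ht x) (not_le.2 (Finset.card_lt_card ?_))
  rw [Finset.ssubset_iff_of_subset]
  · exact ⟨v, by simp [hv, show v ∈ E.bag x from hx], by simp [hvt]⟩
  · intro u hu
    rw [Finset.mem_inter] at hu ⊢
    obtain ⟨z, hzu, hzv⟩ := hK u hu.1 v hv
    exact ⟨hu.1, E.isTree.gate_mem hqp hq (E.joinIn v z x hzv hx)
      (E.joinIn u z t hzu hu.2) q.start_mem_support⟩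

/-- Given a separator `Y` between a part `S` of a bag and `W` such that `S` is linked onto `Y`,
everything on the side of `S` can be contracted onto `Y`. -/
theorem exists_of_linkage [Fintype V] (E : G.PartialDecomposition X M) {W S Y : Finset V}
    (hW : W ⊆ X) {m₀ : M} (hS : S ⊆ E.bag m₀) (hY : G.Separates S W Y) (hl : G.Linkage S Y) :
    ∃ (R : Finset V) (X' : Finset V) (E' : G.PartialDecomposition X' M),
      (R : Set V) ⊆ (X : Set V) \ (S : Set V) ∧ (X' : Set V) = (Y : Set V) ∪ (R : Set V) ∧
      W ⊆ X' ∧ ∀ m, (E'.bag m).card ≤ (E.bag m).card := by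
  classical
  obtain ⟨a, Q, haS, hQ, hQd⟩ := hl
  have hSX : S ⊆ X := hS.trans (E.bag_subset _)
  -- The side of `W`, which is kept; the linkage avoids it.
  let B : Set V := {v | ∃ w ∈ W, G.JoinIn (Y : Set V)ᶜ v w}
  have hBY : ∀ v ∈ B, v ∉ Y := fun v ⟨w, _, h⟩ => h.left_mem
  have hSB : ∀ v ∈ S, v ∉ B := fun v hv ⟨w, hw, h⟩ => hY v hv w hw h
  have hQB : ∀ y ∈ Y, ∀ v ∈ (Q y).support, v ∉ B := by
    intro y hy v hv hvB
    obtain ⟨w, hw, h⟩ := hvB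
    have hvy : v ≠ y := fun h' => h.left_mem (h' ▸ hy)
    refine hY (a y) (haS y hy) w hw (JoinIn.trans ⟨(Q y).takeUntil v hv, fun z hz hzY => ?_⟩ h)
    have hzY : z ∈ Y := hzY
    have := hQd y hy z hzY z ((Q y).support_takeUntil_subset_support hv hz) (Q z).end_mem_support
    subst this
    exact Walk.endpoint_notMem_support_takeUntil (hQ y) hv hvy.symm hz
  let R : Finset V := X.filter (· ∈ B)
  have hRmem : ∀ v, v ∈ R ↔ v ∈ X ∧ v ∈ B := fun v => Finset.mem_filter
  -- Each linkage path is contracted to its end in `Y`, which inherits the bags of all vertices of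
  -- the path.
  let bag : M → Finset V := fun m =>
    (E.bag m).filter (· ∈ B) ∪ Y.filter fun y => ∃ v ∈ (Q y).support, v ∈ E.bag m
  have hbag : ∀ m v, v ∈ bag m ↔ (v ∈ E.bag m ∧ v ∈ B) ∨
      (v ∈ Y ∧ ∃ z ∈ (Q v).support, z ∈ E.bag m) := fun m v => by simp [bag]
  have hbagB : ∀ m v, v ∈ B → (v ∈ bag m ↔ v ∈ E.bag m) := fun m v hv => by
    simp [hbag, hv, hBY v hv]
  have hbagY : ∀ m v, v ∈ Y → (v ∈ bag m ↔ ∃ z ∈ (Q v).support, z ∈ E.bag m) := fun m v hv => by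
    simp [hbag, hv, show v ∉ B from fun h => hBY v h hv]
  -- All paths start in the bag of `m₀`, so this one node serves all pairs of vertices of `Y`.
  have hm₀ : ∀ y ∈ Y, y ∈ bag m₀ := fun y hy =>
    (hbagY _ _ hy).2 ⟨a y, (Q y).start_mem_support, hS (haS y hy)⟩
  have hX' : ∀ v, v ∈ Y ∪ R → v ∉ B → v ∈ Y := fun v hv hvB => by
    simp only [Finset.mem_union, hRmem] at hv
    tauto
  -- the case of the torso condition where one of the two vertices is on the side of `W`
  have htorso : ∀ u ∈ Y ∪ R, ∀ v ∈ Y ∪ R, v ∈ B → ∀ p : G.Walk u v,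
      (∀ w ∈ p.support, w ∈ Y ∪ R → w = u ∨ w = v) → ∃ m, u ∈ bag m ∧ v ∈ bag m := by
    intro u hu v hv hvB p' hp'
    have hvX : v ∈ X := by
      simp only [Finset.mem_union, hRmem] at hv
      exact (hv.resolve_left (hBY v hvB)).1
    obtain ⟨p, hpp, hp⟩ : ∃ p : G.Walk u v, p.IsPath ∧
        ∀ w ∈ p.support, w ∈ Y ∪ R → w = u ∨ w = v :=
      ⟨p'.bypass, p'.bypass_isPath, fun w hw => hp' w (p'.support_bypass_subset_support hw)⟩
    have hin : ∀ w ∈ p.support, w ≠ u → w ∈ B := by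
      intro w hw hwu
      have hw' : w ∈ p.reverse.support := by simpa using hw
      obtain ⟨x, hxW, hx⟩ := hvB
      refine ⟨x, hxW, JoinIn.trans (JoinIn.symm ⟨p.reverse.takeUntil w hw', fun z hz hzY => ?_⟩) hx⟩
      have hzY : z ∈ Y := hzY
      have hzu : z ≠ u := fun h =>
        Walk.endpoint_notMem_support_takeUntil hpp.reverse hw' hwu.symm (h ▸ hz)
      have hzp := p.reverse.support_takeUntil_subset_support hw' hz
      rw [Walk.support_reverse, List.mem_reverse] at hzp
      have := (hp z hzp (Finset.mem_union_left _ hzY)).resolve_left hzu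
      exact hx.left_mem (this ▸ hzY)
    by_cases huB : u ∈ B
    · have huX : u ∈ X := by
        simp only [Finset.mem_union, hRmem] at hu
        exact (hu.resolve_left (hBY u huB)).1
      obtain ⟨m, h1, h2⟩ := E.torso u huX v hvX p fun w hw hwX => by
        by_cases hwu : w = u
        · exact Or.inl hwu
        · exact hp w hw (by simp [hRmem, hwX, hin w hw hwu])
      exact ⟨m, (hbagB _ _ huB).2 h1, (hbagB _ _ hvB).2 h2⟩
    · have huY := hX' u hu huB
      -- The vertex `u` need not lie in `X`; prolonging `p` backwards along `Q u` to the last vertex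
      -- in `X` gives a walk to which the torso condition of `E` applies.
      obtain ⟨z, hz, hzX, q, hq, hq'⟩ := (Q u).exists_last X
        ⟨a u, (Q u).start_mem_support, hSX (haS u huY)⟩
      obtain ⟨m, h1, h2⟩ := E.torso z hzX v hvX (q.append p) fun w hw hwX => by
        rw [Walk.mem_support_append_iff] at hw
        rcases hw with hw | hw
        · exact Or.inl (hq' w hw hwX)
        · by_cases hwu : w = u
          · subst hwu
            exact Or.inl (hq' w q.end_mem_support hwX)
          · exact Or.inr ((hp w hw (by simp [hRmem, hwX, hin w hw hwu])).resolve_left hwu)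
      exact ⟨m, (hbagY _ _ huY).2 ⟨z, hz, h1⟩, (hbagB _ _ hvB).2 h2⟩
  refine ⟨R, Y ∪ R, ⟨E.tree, E.isTree, bag, ?_, ?_, ?_⟩, ?_, by simp, ?_, ?_⟩
  · intro m v hv
    rcases (hbag m v).1 hv with ⟨h1, h2⟩ | ⟨h1, -⟩
    · simp [hRmem, E.bag_subset m h1, h2]
    · simp [h1]
  · intro v m m' hm hm'
    by_cases hvB : v ∈ B
    · rw [hbagB _ _ hvB] at hm hm'
      exact (E.joinIn v m m' hm hm').mono fun x hx => (hbagB _ _ hvB).2 hx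
    · have hvY : v ∈ Y := by
        have := (hbag m v).1 hm
        tauto
      rw [hbagY _ _ hvY] at hm hm'
      obtain ⟨z, hz, hzm⟩ := hm
      obtain ⟨z', hz', hzm'⟩ := hm'
      obtain ⟨r, hr⟩ : G.JoinIn {x | x ∈ (Q v).support} z z' :=
        (JoinIn.of_walk' (Q v) (fun _ h => h) hz).trans
          (JoinIn.of_walk' (Q v) (fun _ h => h) hz').symm
      refine (E.joinIn_of_walk r (E.bag_subset _ hzm) (E.bag_subset _ hzm') hzm hzm').mono ?_
      rintro n ⟨w, hw, hwn⟩
      exact (hbagY _ _ hvY).2 ⟨w, hr w hw, hwn⟩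
  · intro u hu v hv p hp
    by_cases hvB : v ∈ B
    · exact htorso u hu v hv hvB p hp
    by_cases huB : u ∈ B
    · obtain ⟨m, h1, h2⟩ := htorso v hv u hu huB p.reverse fun w hw hwX =>
        (hp w (by simpa using hw) hwX).symm
      exact ⟨m, h2, h1⟩
    · exact ⟨m₀, hm₀ u (hX' u hu huB), hm₀ v (hX' v hv hvB)⟩
  · intro v hv
    obtain ⟨h1, h2⟩ := (hRmem v).1 hv
    exact ⟨h1, fun h => hSB v h h2⟩
  · intro w hw
    by_cases hwY : w ∈ Y
    · simp [hwY]
    · have : w ∈ B := ⟨w, hw, .refl hwY⟩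
      simp [hRmem, hW hw, this]
  · intro m
    have hc : ∀ y, ∃ v, y ∈ Y → (∃ v ∈ (Q y).support, v ∈ E.bag m) →
        v ∈ (Q y).support ∧ v ∈ E.bag m := fun y => by
      by_cases h : ∃ v ∈ (Q y).support, v ∈ E.bag m
      · obtain ⟨v, hv⟩ := h
        exact ⟨v, fun _ _ => hv⟩
      · exact ⟨y, fun _ h' => absurd h' h⟩
    choose c hc using hc
    have hg : ∀ v ∈ bag m, v ∉ B → v ∈ Y ∧ c v ∈ (Q v).support ∧ c v ∈ E.bag m := by
      intro v hv hvB
      have hvY : v ∈ Y := by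
        have := (hbag m v).1 hv
        tauto
      exact ⟨hvY, hc v hvY ((hbagY _ _ hvY).1 hv)⟩
    -- A contracted path occupies a new bag only if one of its vertices was in the old one;
    -- disjointness of the paths makes this choice injective.
    refine Finset.card_le_card_of_injOn (fun v => if v ∈ B then v else c v) ?_ ?_
    · intro v hv
      by_cases hvB : v ∈ B
      · simpa [hvB] using (hbagB _ _ hvB).1 hv
      · simpa [hvB] using (hg v hv hvB).2.2
    · intro v hv v' hv' he
      by_cases h1 : v ∈ B <;> by_cases h2 : v' ∈ B <;> simp only [h1, h2, if_true, if_false] at he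
      · exact he
      · obtain ⟨h3, h4, -⟩ := hg v' hv' h2
        exact absurd (he ▸ h1) (hQB v' h3 _ h4)
      · obtain ⟨h3, h4, -⟩ := hg v hv h1
        exact absurd (he ▸ h2) (hQB v h3 _ h4)
      · obtain ⟨h3, h4, -⟩ := hg v hv h1
        obtain ⟨h5, h6, -⟩ := hg v' hv' h2
        exact hQd v h3 v' h5 _ h4 (he ▸ h6)

/-- The node `s` lies on every walk of the tree from a node whose bag contains `v` to `r`. -/
def Between (E : G.PartialDecomposition X M) (v : V) (r s : M) : Prop :=
  ∀ m, v ∈ E.bag m → ∀ p : E.tree.Walk m r, s ∈ p.support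

/-- If `s` lies between the nodes of `v` and `r`, then the bag of `s` meets all walks of `G`
from `v` to the bag of `r`. -/
theorem Between.exists_mem_bag {E : G.PartialDecomposition X M} {v w : V} {r s : M}
    (h : E.Between v r s) (hv : v ∈ X) (hw : w ∈ E.bag r) (p : G.Walk v w) :
    ∃ x ∈ p.support, x ∈ E.bag s := by
  obtain ⟨m, hm⟩ := E.exists_mem_bag hv
  obtain ⟨q, hq⟩ := E.joinIn_of_walk p hv (E.bag_subset _ hw) hm hw
  exact hq s (h m hm q)

/-- The nodes between `v` and `r` include the path from the gate of the subtree of `v` to `r`. So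
putting `v` into their bags keeps its nodes connected and takes it to the root. -/
theorem joinIn_between (E : G.PartialDecomposition X M) {v : V} (hv : v ∈ X) {r s : M}
    (hs : v ∈ E.bag s ∨ E.Between v r s) :
    E.tree.JoinIn {n | v ∈ E.bag n ∨ E.Between v r n} s r := by
  classical
  obtain ⟨m, hm⟩ := E.exists_mem_bag hv
  obtain ⟨x, hx, q, hqp, hq⟩ := E.isTree.connected.exists_gate (A := {n | v ∈ E.bag n}) hm r
  have hqA : ∀ y ∈ q.support, y ∈ {n | v ∈ E.bag n ∨ E.Between v r n} := fun y hy =>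
    Or.inr fun z hz p => E.isTree.gate_mem (B := {n | n ∈ p.support}) hqp hq
      (E.joinIn v z x hz hx) ⟨p, fun _ h => h⟩ hy
  rcases hs with hs | hs
  · exact ((E.joinIn v s x hs hx).mono fun y hy => Or.inl hy).trans ⟨q, hqA⟩
  · exact JoinIn.of_walk' q hqA (hs x hx q)

/-- The distance in the tree from the nodes whose bags contain `v` to `r`. -/
noncomputable def distTo (E : G.PartialDecomposition X M) (r : M) (v : V) : ℕ :=
  sInf {n | ∃ m, v ∈ E.bag m ∧ E.tree.dist m r = n}

theorem distTo_le (E : G.PartialDecomposition X M) {r m : M} {v : V} (h : v ∈ E.bag m) :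
    E.distTo r v ≤ E.tree.dist m r :=
  Nat.sInf_le ⟨m, h, rfl⟩

/-- A shortest path from a node of `v` to `r` passes through `s` but does not start there. -/
theorem Between.dist_lt {E : G.PartialDecomposition X M} {v : V} {r s : M}
    (h : E.Between v r s) (hv : v ∈ X) (hs : v ∉ E.bag s) : E.tree.dist s r < E.distTo r v := by
  classical
  obtain ⟨m₀, hm₀⟩ := E.exists_mem_bag hv
  obtain ⟨m, hm, hd⟩ : E.distTo r v ∈ {n | ∃ m, v ∈ E.bag m ∧ E.tree.dist m r = n} :=
    Nat.sInf_mem ⟨_, m₀, hm₀, rfl⟩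
  obtain ⟨p, hp⟩ := E.isTree.connected.exists_walk_length_eq_dist m r
  have hsp := h m hm p
  have hne : s ≠ m := fun h' => hs (h' ▸ hm)
  rw [← hd, ← hp]
  exact (dist_le _).trans_lt (p.length_dropUntil_lt_length hsp hne)

end PartialDecomposition

/-! ### Weights and minimum torsos -/

/-- The function `d`, shifted so that sums of its values compare cardinalities first. -/
def weight {V : Type*} [Fintype V] (d : V → ℕ) (v : V) : ℕ := (∑ u, d u) + 1 + d v

/-- The shift exceeds the sum of all values of `d`, so one more vertex outweighs any gain in `d`. -/
theorem card_le_of_sum_weight_le {V : Type*} [Fintype V] {d : V → ℕ} {A B : Finset V}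
    (h : ∑ v ∈ A, weight d v ≤ ∑ v ∈ B, weight d v) : A.card ≤ B.card := by
  simp only [weight, Finset.sum_add_distrib, Finset.sum_const, smul_eq_mul] at h
  have hB : ∑ v ∈ B, d v ≤ ∑ v, d v := Finset.sum_le_sum_of_subset (Finset.subset_univ B)
  by_contra! hlt
  have : (B.card + 1) * (∑ v, d v) ≤ A.card * ∑ v, d v := Nat.mul_le_mul_right _ hlt
  linarith [Nat.zero_le (∑ v ∈ A, d v)]

/-- If replacing `F` by `Y` in `S` does not decrease the sum of weights, but the weights on `Y` are
smaller than those on `F`, then `F` is smaller than `Y` or both are empty. -/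
theorem card_le_of_sum_weight_sdiff_union_le {V : Type*} [Fintype V] [DecidableEq V] {d : V → ℕ}
    {S F Y : Finset V} (hF : F ⊆ S)
    (h : ∑ v ∈ S, weight d v ≤ ∑ v ∈ (S \ F) ∪ Y, weight d v) :
    F.card ≤ Y.card ∧ (F.card = Y.card → (∀ x ∈ F, ∀ y ∈ Y, d y < d x) → Y = ∅) := by
  have h1 : ∑ v ∈ F, weight d v ≤ ∑ v ∈ Y, weight d v := by
    have h2 := Finset.sum_sdiff (f := weight d) hF
    have h3 := Finset.sum_union_inter (s₁ := S \ F) (s₂ := Y) (f := weight d)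
    omega
  refine ⟨card_le_of_sum_weight_le h1, fun hc hd => ?_⟩
  by_contra hne
  have hY : Y.Nonempty := Finset.nonempty_iff_ne_empty.2 hne
  obtain ⟨y, hy, hmax⟩ := Y.exists_max_image (weight d) hY
  have hFne : F.Nonempty := by rw [← Finset.card_pos, hc]; exact hY.card_pos
  have h4 : ∑ v ∈ Y, weight d v ≤ Y.card * weight d y := by
    simpa using Finset.sum_le_card_nsmul Y (weight d) (weight d y) hmax
  have h5 : F.card * weight d y < ∑ v ∈ F, weight d v := by
    rw [← smul_eq_mul, ← Finset.sum_const]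
    exact Finset.sum_lt_sum_of_nonempty hFne fun x hx => by
      have := hd x hx y hy
      unfold weight
      omega
  rw [hc] at h5
  omega

/-- In a partial decomposition of minimum weight, no part of a bag is separated from `W` by a set
of smaller weight. -/
theorem PartialDecomposition.sum_weight_le_of_separates {V M : Type*} [Fintype V]
    {G : SimpleGraph V} {X : Finset V} (E : G.PartialDecomposition X M) {W : Finset V}
    (hW : W ⊆ X) (d : V → ℕ)
    (hmin : ∀ (X' : Finset V) (E' : G.PartialDecomposition X' M), W ⊆ X' →
      (∀ m, (E'.bag m).card ≤ (E.bag m).card) → ∑ v ∈ X, weight d v ≤ ∑ v ∈ X', weight d v)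
    {m₀ : M} {S Y : Finset V} (hS : S ⊆ E.bag m₀) (hY : G.Separates S W Y) :
    ∑ v ∈ S, weight d v ≤ ∑ v ∈ Y, weight d v := by
  classical
  obtain ⟨Z, hZ, hZmin⟩ := Set.exists_min_image {Z | G.Separates S W Z}
    (fun Z => ∑ v ∈ Z, weight d v) (Set.toFinite _) ⟨Y, hY⟩
  refine le_trans ?_ (hZmin Y hY)
  -- A set separating `S` from the separator `Z` also separates `S` from `W`, so it is no smaller
  -- than `Z` and Menger's theorem applies.
  have hl : G.Linkage S Z := by
    refine (disjointWalks_of_forall_separates _ G S Z fun Z' hZ' => ?_).linkage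
    refine card_le_of_sum_weight_le (hZmin Z' fun a ha b hb hab => ?_)
    obtain ⟨z, hz, h⟩ := hab.exists_mem (hZ a ha b hb)
    exact hZ' a ha z hz h
  obtain ⟨R, X', E', hR, hX', hWX', hcard⟩ := E.exists_of_linkage hW hS hZ hl
  have h1 := hmin X' E' hWX' hcard
  have hX'' : X' = Z ∪ R := by
    rw [← Finset.coe_inj, hX', Finset.coe_union]
  have h2 : ∑ v ∈ X', weight d v ≤ ∑ v ∈ Z, weight d v + ∑ v ∈ R, weight d v := by
    rw [hX'', ← Finset.sum_union_inter]
    exact Nat.le_add_right _ _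
  have h3 : ∑ v ∈ S, weight d v + ∑ v ∈ R, weight d v ≤ ∑ v ∈ X, weight d v := by
    rw [← Finset.sum_union]
    · exact Finset.sum_le_sum_of_subset (Finset.union_subset (hS.trans (E.bag_subset _))
        fun v hv => (hR hv).1)
    · exact Finset.disjoint_left.2 fun v hv hv' => (hR hv').2 hv
  omega


/-! ### Gluing copies of a tree to a tree -/

/-- The disjoint union of the tree `TM` and of copies of the tree `TN`, the `i`-th one attached
with its node `r i` to the node `m i` of `TM`. -/
def glueTree {M N ι : Type*} (TM : SimpleGraph M) (TN : SimpleGraph N) (m : ι → M) (r : ι → N) :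
    SimpleGraph (M ⊕ ι × N) where
  Adj
    | .inl a, .inl b => TM.Adj a b
    | .inr (i, s), .inr (j, t) => i = j ∧ TN.Adj s t
    | .inl a, .inr (i, s) => a = m i ∧ s = r i
    | .inr (i, s), .inl a => a = m i ∧ s = r i
  symm := by
    constructor
    rintro (a | ⟨i, s⟩) (b | ⟨j, t⟩) h
    · exact SimpleGraph.Adj.symm h
    · exact h
    · exact h
    · exact ⟨h.1.symm, SimpleGraph.Adj.symm h.2⟩
  loopless := by
    constructor
    rintro (a | ⟨i, s⟩) h
    · exact TM.irrefl h
    · exact TN.irrefl h.2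

theorem glueTree_adj_inr {M N ι : Type*} {TM : SimpleGraph M} {TN : SimpleGraph N} {m : ι → M}
    {r : ι → N} (i : ι) {s t : N} (h : TN.Adj s t) :
    (glueTree TM TN m r).Adj (.inr (i, s)) (.inr (i, t)) := ⟨rfl, h⟩

theorem glueTree_adj_anchor {M N ι : Type*} {TM : SimpleGraph M} {TN : SimpleGraph N} {m : ι → M}
    {r : ι → N} (i : ι) : (glueTree TM TN m r).Adj (.inr (i, r i)) (.inl (m i)) := ⟨rfl, rfl⟩

/-- Used both with embeddings, for connectedness, and with contractions, which reduce the bridge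
property in a glued tree to that in one of its pieces. -/
theorem Reachable.of_collapse {N K : Type*} {T : SimpleGraph N} {H : SimpleGraph K} {f : N → K}
    (hf : ∀ a b, T.Adj a b → f a = f b ∨ H.Adj (f a) (f b)) {a b : N} (h : T.Reachable a b) :
    H.Reachable (f a) (f b) := by
  obtain ⟨p⟩ := h
  induction p with
  | nil => rfl
  | cons hadj _ ih =>
    rcases hf _ _ hadj with h | h
    · rwa [h]
    · exact h.reachable.trans ih

theorem JoinIn.map {N K : Type*} {T : SimpleGraph N} {H : SimpleGraph K} {f : N → K}
    (hf : ∀ a b, T.Adj a b → H.Adj (f a) (f b)) {A : Set N} {B : Set K}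
    (hAB : ∀ a ∈ A, f a ∈ B) {a b : N} (h : T.JoinIn A a b) : H.JoinIn B (f a) (f b) := by
  obtain ⟨p, hp⟩ := h
  induction p with
  | nil => exact .refl (hAB _ (hp _ (by simp)))
  | cons hadj q ih =>
    simp only [Walk.support_cons, List.mem_cons, forall_eq_or_imp] at hp
    exact (JoinIn.of_adj (hf _ _ hadj) (hAB _ hp.1) (hAB _ (hp.2 _ q.start_mem_support))).trans
      (ih hp.2)

/-- Every edge is a bridge. For an edge of `TM` each copy is contracted to its anchor; for an edge
of the `i`-th copy everything else is contracted to its root; for an attaching edge only membership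
in the copy is retained. -/
theorem isTree_glueTree {M N ι : Type*} {TM : SimpleGraph M} {TN : SimpleGraph N} (m : ι → M)
    (r : ι → N) (hM : TM.IsTree) (hN : TN.IsTree) : (glueTree TM TN m r).IsTree := by
  classical
  have hMa := isAcyclic_iff_forall_adj_isBridge.1 hM.isAcyclic
  have hNa := isAcyclic_iff_forall_adj_isBridge.1 hN.isAcyclic
  have hlink : ∀ i, (glueTree TM TN m r).Adj (.inl (m i)) (.inr (i, r i)) := fun i => ⟨rfl, rfl⟩
  obtain ⟨m₀⟩ := hM.connected.nonempty
  have hreach : ∀ x, (glueTree TM TN m r).Reachable x (.inl m₀) := by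
    have hin : ∀ a, (glueTree TM TN m r).Reachable (.inl a) (.inl m₀) := fun a =>
      Reachable.of_collapse (H := glueTree TM TN m r) (f := Sum.inl) (fun a b h => Or.inr h)
        (hM.connected.preconnected a m₀)
    rintro (a | ⟨i, s⟩)
    · exact hin a
    · exact (Reachable.of_collapse (H := glueTree TM TN m r) (f := fun s => Sum.inr (i, s))
        (fun a b h => Or.inr ⟨rfl, h⟩) (hN.connected.preconnected s (r i))).trans
        ((hlink i).symm.reachable.trans (hin _))
  have : Nonempty (M ⊕ ι × N) := ⟨.inl m₀⟩
  refine ⟨⟨fun x y => (hreach x).trans (hreach y).symm⟩, isAcyclic_iff_forall_adj_isBridge.2 ?_⟩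
  -- an attaching edge
  have hbridge : ∀ i, (glueTree TM TN m r).IsBridge s(.inl (m i), .inr (i, r i)) := by
    intro i h
    let f : M ⊕ ι × N → Bool := Sum.elim (fun _ => false) fun x => decide (x.1 = i)
    have := Reachable.of_collapse (H := (⊥ : SimpleGraph Bool)) (f := f) (fun a b hab => ?_) h
    · simp [f] at this
    · left
      rw [deleteEdges_adj] at hab
      obtain ⟨hab, hne⟩ := hab
      rcases a with a | ⟨j, s⟩ <;> rcases b with b | ⟨k, t⟩
      · rfl
      · obtain ⟨rfl, rfl⟩ := hab
        have : k ≠ i := by rintro rfl; simp at hne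
        simp [f, this]
      · obtain ⟨rfl, rfl⟩ := hab
        have : j ≠ i := by rintro rfl; simp at hne
        simp [f, this]
      · obtain ⟨rfl, -⟩ := hab
        rfl
  rintro (a | ⟨i, s⟩) (b | ⟨j, t⟩) hadj
  · intro h
    have hab : TM.Adj a b := hadj
    refine hMa hab (Reachable.of_collapse
      (f := (Sum.elim id fun x => m x.1 : M ⊕ ι × N → M)) (fun c d hcd => ?_) h)
    rw [deleteEdges_adj] at hcd
    obtain ⟨hcd, hne⟩ := hcd
    rcases c with c | ⟨j, s⟩ <;> rcases d with d | ⟨k, t⟩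
    · right
      rw [deleteEdges_adj]
      refine ⟨hcd, fun h' => hne ?_⟩
      simpa using h'
    · exact Or.inl hcd.1
    · exact Or.inl hcd.1.symm
    · obtain ⟨rfl, -⟩ := hcd
      exact Or.inl rfl
  · obtain ⟨rfl, rfl⟩ := hadj
    exact hbridge j
  · obtain ⟨rfl, rfl⟩ := hadj
    rw [Sym2.eq_swap]
    exact hbridge i
  · obtain ⟨rfl, hst⟩ := hadj
    intro h
    let f : M ⊕ ι × N → N := Sum.elim (fun _ => r i) fun x => if x.1 = i then x.2 else r i
    have := Reachable.of_collapse (H := TN.deleteEdges {s(s, t)}) (f := f) (fun c d hcd => ?_) h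
    · exact hNa hst (by simpa [f] using this)
    rw [deleteEdges_adj] at hcd
    obtain ⟨hcd, hne⟩ := hcd
    rcases c with c | ⟨j, x⟩ <;> rcases d with d | ⟨k, y⟩
    · exact Or.inl rfl
    · obtain ⟨rfl, rfl⟩ := hcd
      left
      by_cases hk : k = i <;> simp [f, hk]
    · obtain ⟨rfl, rfl⟩ := hcd
      left
      by_cases hk : j = i <;> simp [f, hk]
    · obtain ⟨rfl, hxy⟩ := hcd
      by_cases hk : j = i
      · subst hk
        right
        simp only [f, Sum.elim_inr, if_true]
        rw [deleteEdges_adj]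
        refine ⟨hxy, fun h' => hne ?_⟩
        simpa using h'
      · left
        simp [f, hk]

/-! ### Gluing decompositions and exchanging vertices -/

namespace PartialDecomposition

/-- A decomposition of the whole graph from the usual axioms. -/
def ofCover {V N : Type*} [Fintype V] {G : SimpleGraph V} (T : SimpleGraph N) (hT : T.IsTree)
    (bag : N → Finset V) (hv : ∀ v, ∃ t, v ∈ bag t)
    (he : ∀ u v, G.Adj u v → ∃ t, u ∈ bag t ∧ v ∈ bag t)
    (hj : ∀ v m m', v ∈ bag m → v ∈ bag m' → T.JoinIn {n | v ∈ bag n} m m') :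
    G.PartialDecomposition Finset.univ N where
  tree := T
  isTree := hT
  bag := bag
  bag_subset _ := Finset.subset_univ _
  joinIn := hj
  torso u _ v _ p hp := by
    cases p with
    | nil =>
      obtain ⟨t, ht⟩ := hv u
      exact ⟨t, ht, ht⟩
    | cons hadj q =>
      rcases hp _ (List.mem_cons_of_mem _ q.start_mem_support) (Finset.mem_univ _) with h | h
      · exact absurd (h ▸ hadj) (G.irrefl)
      · subst h
        exact he _ _ hadj

/-- Data for the replacement of a decomposition `D` by a partial decomposition `E` with copies of
`D` attached to it, one for each of the parts `C i` of the complement of the torso. -/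
structure Gluing {V M N : Type*} [Fintype V] {G : SimpleGraph V} {X : Finset V}
    (D : G.PartialDecomposition Finset.univ N) (E : G.PartialDecomposition X M) (ι : Type*) where
  /-- the parts of the complement -/
  part : ι → Finset V
  /-- a set containing the neighbours of the part -/
  border : ι → Finset V
  /-- the node of `E` to which the copy is attached -/
  anchor : ι → M
  /-- the node of `D` at which the copy is attached -/
  root : ι → N
  notMem_of_mem_part : ∀ i, ∀ v ∈ part i, v ∉ X
  exists_part : ∀ v ∉ X, ∃ i, v ∈ part i
  part_unique : ∀ v i j, v ∈ part i → v ∈ part j → i = j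
  adj_part : ∀ i u v, u ∈ part i → G.Adj u v → v ∈ part i ∨ v ∈ border i
  border_subset : ∀ i, border i ⊆ E.bag (anchor i)

namespace Gluing

variable {V M N ι : Type*} [Fintype V] {G : SimpleGraph V} {X : Finset V}
  {D : G.PartialDecomposition Finset.univ N} {E : G.PartialDecomposition X M}

theorem border_subset_carrier (g : Gluing D E ι) (i : ι) : g.border i ⊆ X :=
  (g.border_subset i).trans (E.bag_subset _)

open Classical in
/-- The vertices that are added to the bag of `s` in the `i`-th copy. -/
noncomputable def added (g : Gluing D E ι) (i : ι) (s : N) : Finset V :=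
  (g.border i).filter fun v => D.Between v (g.root i) s ∧ v ∉ D.bag s

theorem mem_added (g : Gluing D E ι) {i : ι} {s : N} {v : V} :
    v ∈ g.added i s ↔ v ∈ g.border i ∧ D.Between v (g.root i) s ∧ v ∉ D.bag s := by
  simp [added]

variable [DecidableEq V]

/-- The vertices that are removed from the bag of `s` in the `i`-th copy. -/
def removed (g : Gluing D E ι) (i : ι) (s : N) : Finset V :=
  D.bag s \ (g.part i ∪ g.border i)

/-- The bags of the new decomposition. -/
noncomputable def bag (g : Gluing D E ι) : M ⊕ ι × N → Finset V
  | .inl a => E.bag a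
  | .inr (i, s) => (D.bag s \ g.removed i s) ∪ g.added i s

theorem mem_removed (g : Gluing D E ι) {i : ι} {s : N} {v : V} :
    v ∈ g.removed i s ↔ v ∈ D.bag s ∧ v ∉ g.part i ∧ v ∉ g.border i := by
  simp [removed]

theorem mem_bag_inr (g : Gluing D E ι) {i : ι} {s : N} {v : V} :
    v ∈ g.bag (.inr (i, s)) ↔ (v ∈ g.part i ∧ v ∈ D.bag s) ∨
      (v ∈ g.border i ∧ (v ∈ D.bag s ∨ D.Between v (g.root i) s)) := by
  simp only [bag, Finset.mem_union, Finset.mem_sdiff, mem_removed, mem_added]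
  tauto

theorem card_bag_inr (g : Gluing D E ι) (i : ι) (s : N) :
    (g.bag (.inr (i, s))).card + (g.removed i s).card = (D.bag s).card + (g.added i s).card := by
  have h1 : Disjoint (D.bag s \ g.removed i s) (g.added i s) :=
    Finset.disjoint_left.2 fun v hv hv' => (g.mem_added.1 hv').2.2 (Finset.mem_sdiff.1 hv).1
  have h2 : g.removed i s ⊆ D.bag s := Finset.sdiff_subset
  have h3 := Finset.card_sdiff_add_card_eq_card h2
  simp only [bag]
  rw [Finset.card_union_of_disjoint h1]
  omega

theorem mem_of_mem_part (g : Gluing D E ι) {i j : ι} {s : N} {v : V} (hv : v ∈ g.part i)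
    (h : v ∈ g.bag (.inr (j, s))) : j = i ∧ v ∈ D.bag s := by
  rcases g.mem_bag_inr.1 h with ⟨h1, h2⟩ | ⟨h1, -⟩
  · exact ⟨g.part_unique v _ _ h1 hv, h2⟩
  · exact absurd (g.border_subset_carrier j h1) (g.notMem_of_mem_part i v hv)

/-- The new decomposition. -/
noncomputable def decomposition (g : Gluing D E ι) :
    G.PartialDecomposition Finset.univ (M ⊕ ι × N) :=
  ofCover (glueTree E.tree D.tree g.anchor g.root) (isTree_glueTree _ _ E.isTree D.isTree) g.bag
    (fun v => by
      by_cases hv : v ∈ X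
      · obtain ⟨m, hm⟩ := E.exists_mem_bag hv
        exact ⟨.inl m, hm⟩
      · obtain ⟨i, hi⟩ := g.exists_part v hv
        obtain ⟨s, hs⟩ := D.exists_mem_bag (Finset.mem_univ v)
        exact ⟨.inr (i, s), g.mem_bag_inr.2 (Or.inl ⟨hi, hs⟩)⟩)
    (by
      have key : ∀ u v, u ∉ X → G.Adj u v → ∃ t, u ∈ g.bag t ∧ v ∈ g.bag t := by
        intro u v hu hadj
        obtain ⟨i, hi⟩ := g.exists_part u hu
        obtain ⟨s, hs, hs'⟩ := D.torso u (Finset.mem_univ _) v (Finset.mem_univ _)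
          (.cons hadj .nil) (by simp)
        refine ⟨.inr (i, s), g.mem_bag_inr.2 (Or.inl ⟨hi, hs⟩), g.mem_bag_inr.2 ?_⟩
        rcases g.adj_part i u v hi hadj with h | h
        · exact Or.inl ⟨h, hs'⟩
        · exact Or.inr ⟨h, Or.inl hs'⟩
      intro u v hadj
      by_cases hu : u ∈ X
      · by_cases hv : v ∈ X
        · obtain ⟨m, hm⟩ := E.torso u hu v hv (.cons hadj .nil) (by simp)
          exact ⟨.inl m, hm⟩
        · obtain ⟨t, h1, h2⟩ := key v u hv hadj.symm
          exact ⟨t, h2, h1⟩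
      · exact key u v hu hadj)
    (by
      intro v n n' hn hn'
      by_cases hv : v ∈ X
      · obtain ⟨a₀, ha₀⟩ := E.exists_mem_bag hv
        have hin : ∀ a, v ∈ E.bag a → (glueTree E.tree D.tree g.anchor g.root).JoinIn
            {n | v ∈ g.bag n} (.inl a) (.inl a₀) := fun a ha =>
          (E.joinIn v a a₀ ha ha₀).map (f := Sum.inl) (fun _ _ h => h) fun _ h => h
        have key : ∀ n, v ∈ g.bag n → (glueTree E.tree D.tree g.anchor g.root).JoinIn
            {n | v ∈ g.bag n} n (.inl a₀) := by
          rintro (a | ⟨i, s⟩) h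
          · exact hin a h
          · obtain ⟨hi, hs⟩ := (g.mem_bag_inr.1 h).resolve_left
              fun h' => g.notMem_of_mem_part i v h'.1 hv
            have h1 : (glueTree E.tree D.tree g.anchor g.root).JoinIn
                {n | v ∈ g.bag n} (.inr (i, s)) (.inr (i, g.root i)) :=
              (D.joinIn_between (Finset.mem_univ v) hs).map (f := fun s => Sum.inr (i, s))
                (fun _ _ h => glueTree_adj_inr _ h) fun x hx => g.mem_bag_inr.2 (Or.inr ⟨hi, hx⟩)
            have h2 : v ∈ E.bag (g.anchor i) := g.border_subset i hi
            exact h1.trans ((JoinIn.of_adj (glueTree_adj_anchor i) h1.right_mem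
              h2).trans (hin _ h2))
        exact (key n hn).trans (key n' hn').symm
      · obtain ⟨i, hi⟩ := g.exists_part v hv
        rcases n with a | ⟨j, s⟩
        · exact absurd (E.bag_subset a hn) hv
        rcases n' with a | ⟨k, t⟩
        · exact absurd (E.bag_subset a hn') hv
        obtain ⟨rfl, hs⟩ := g.mem_of_mem_part hi hn
        obtain ⟨rfl, ht⟩ := g.mem_of_mem_part hi hn'
        exact (D.joinIn v s t hs ht).map (f := fun s => Sum.inr (k, s))
          (fun _ _ h => glueTree_adj_inr _ h) fun x hx => g.mem_bag_inr.2 (Or.inl ⟨hi, hx⟩))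

/-- If in the border the vertices added at some node are exchanged for those removed there, then
the result separates the part and the border from the vertices in the bag of the root that lie
outside the part. -/
theorem separates_exchange (g : Gluing D E ι) (i : ι) (s : N) {A W : Finset V}
    (hA : A ⊆ g.part i ∪ g.border i) (hW : W ⊆ D.bag (g.root i))
    (hWC : ∀ w ∈ W, w ∉ g.part i) :
    G.Separates A W ((g.border i \ g.added i s) ∪ g.removed i s) := by
  rintro a ha w hw ⟨p, hp⟩
  have hmeet : ∃ x ∈ p.support, x ∈ (g.border i : Set V) := by
    by_contra hc
    push Not at hc
    refine hWC w hw (p.forall_mem_of_closed (C := {v | v ∈ g.part i}) ?_ ?_ w p.end_mem_support)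
    · exact (Finset.mem_union.1 (hA ha)).resolve_right (hc a p.start_mem_support)
    · exact fun x hx y hy hadj => (g.adj_part i x y hx hadj).resolve_right (hc y hy)
  -- After the last visit to the border, at an added vertex `x`, the walk cannot be in the part, as
  -- it would have to cross the border again to reach `w`. But `s` lies between `x` and the root, so
  -- this segment meets the bag of `s`, and does so in a removed vertex.
  obtain ⟨x, hx, hxS, q, hqp, hq, hqS⟩ : ∃ x ∈ p.support, x ∈ g.border i ∧ ∃ q : G.Walk x w,
      q.IsPath ∧ (∀ y ∈ q.support, y ∈ p.support) ∧ ∀ y ∈ q.support, y ∈ g.border i → y = x := by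
    obtain ⟨x, hx, hxS, q, hq, hqS⟩ := p.exists_last _ hmeet
    exact ⟨x, hx, hxS, q.bypass, q.bypass_isPath,
      fun y hy => hq y (q.support_bypass_subset_support hy),
      fun y hy => hqS y (q.support_bypass_subset_support hy)⟩
  have hxF : x ∈ g.added i s := by
    by_contra hc
    exact hp x hx (by simp [hc, hxS])
  obtain ⟨-, hbt, hxs⟩ := g.mem_added.1 hxF
  obtain ⟨y, hy, hys⟩ := hbt.exists_mem_bag (Finset.mem_univ x) (hW hw) q
  have hyx : y ≠ x := fun h => hxs (h ▸ hys)
  have hyS : y ∉ g.border i := fun h => hyx (hqS y hy h)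
  refine hp y (hq y hy) ?_
  have hyC : y ∉ g.part i := by
    intro hyC
    have hy' : y ∈ q.reverse.support := by simpa using hy
    refine hWC w hw ((q.reverse.takeUntil y hy').reverse.forall_mem_of_closed
      (C := {v | v ∈ g.part i}) hyC (fun u hu z hz hadj => ?_) w (Walk.end_mem_support _))
    refine (g.adj_part i u z hu hadj).resolve_right fun hzS => ?_
    rw [Walk.support_reverse, List.mem_reverse] at hz
    have hzq := q.reverse.support_takeUntil_subset_support hy' hz
    rw [Walk.support_reverse, List.mem_reverse] at hzq
    have := hqS z hzq hzS
    subst this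
    exact Walk.endpoint_notMem_support_takeUntil hqp.reverse hy' hyx.symm hz
  simp [g.mem_removed, hys, hyC, hyS]

end Gluing

end PartialDecomposition


/-! ### Profiles -/

namespace PartialDecomposition

variable {V N K : Type*} [Fintype V] {G : SimpleGraph V} {X : Finset V}

/-- The number of bags of size `j`. -/
def count [Fintype N] (D : G.PartialDecomposition X N) (j : ℕ) : ℕ :=
  (Finset.univ.filter fun s => (D.bag s).card = j).card

/-- The numbers of bags of each size, to be compared from the largest size downwards. -/
def profile [Fintype N] (D : G.PartialDecomposition X N) :
    Colex (Fin (Fintype.card V + 1) → ℕ) :=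
  toColex fun j => D.count j

theorem profile_lt_profile [Fintype N] [Fintype K] {D : G.PartialDecomposition X N}
    {D' : G.PartialDecomposition X K} {j : ℕ} (hle : ∀ i, j ≤ i → D'.count i ≤ D.count i)
    (hlt : D'.count j < D.count j) : D'.profile < D.profile := by
  have hj : j < Fintype.card V + 1 := by
    by_contra! h
    have : D.count j = 0 := by
      refine Finset.card_eq_zero.2 (Finset.filter_eq_empty_iff.2 fun s _ hs => ?_)
      have := Finset.card_le_univ (D.bag s)
      omega
    omega
  -- The colexicographic comparison is decided by the largest index at which the counts differ.
  obtain ⟨i, hi, hmax⟩ := (Finset.univ.filter fun i : Fin (Fintype.card V + 1) =>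
    j ≤ i ∧ D'.count i ≠ D.count i).exists_max_image id
      ⟨⟨j, hj⟩, by simp [hlt.ne]⟩
  simp only [Finset.mem_filter, Finset.mem_univ, true_and] at hi
  refine ⟨i, fun l hl => ?_, lt_of_le_of_ne (hle i hi.1) hi.2⟩
  by_contra hne
  have := hmax l (by
    simp only [Finset.mem_filter, Finset.mem_univ, true_and]
    exact ⟨hi.1.trans (Fin.le_def.1 (le_of_lt hl)), hne⟩)
  exact absurd hl (not_lt.2 this)

/-- Renaming of the nodes. -/
def reindex (D : G.PartialDecomposition X N) (e : K ≃ N) : G.PartialDecomposition X K where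
  tree := D.tree.comap e
  isTree := (Iso.isTree_iff (Iso.comap e D.tree)).2 D.isTree
  bag k := D.bag (e k)
  bag_subset k := D.bag_subset (e k)
  joinIn v k k' hk hk' := by
    have := (D.joinIn v (e k) (e k') hk hk').map (H := D.tree.comap e) (f := e.symm)
      (B := {n | v ∈ D.bag (e n)}) (fun a b h => by simpa using h) (fun a ha => by simpa using ha)
    simpa using this
  torso u hu v hv p hp := by
    obtain ⟨m, hm⟩ := D.torso u hu v hv p hp
    exact ⟨e.symm m, by simpa using hm⟩

theorem profile_reindex [Fintype N] [Fintype K] (D : G.PartialDecomposition X N) (e : K ≃ N) :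
    (D.reindex e).profile = D.profile := by
  unfold profile count
  congr 1
  funext j
  exact Finset.card_equiv e fun i => by rw [Finset.mem_filter_univ, Finset.mem_filter_univ]; rfl

/-- The decomposition with `X` as its only bag. -/
def single (X : Finset V) [Unique N] : G.PartialDecomposition X N where
  tree := ⊥
  isTree := .of_subsingleton
  bag _ := X
  bag_subset _ := subset_rfl
  joinIn v m m' hm hm' := by
    obtain rfl := Subsingleton.elim m m'
    exact .refl hm
  torso u hu v hv _ _ := ⟨default, hu, hv⟩

variable (G) in
/-- There is a decomposition of minimum profile. -/
theorem exists_minimal_profile : ∃ (n : ℕ) (D : G.PartialDecomposition Finset.univ (Fin n)),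
    ∀ (k : ℕ) (D' : G.PartialDecomposition Finset.univ (Fin k)), ¬ D'.profile < D.profile := by
  obtain ⟨_, ⟨n, D, rfl⟩, hmin⟩ :=
    (wellFounded_lt (α := Colex (Fin (Fintype.card V + 1) → ℕ))).has_min
      {x | ∃ (n : ℕ) (D : G.PartialDecomposition Finset.univ (Fin n)), D.profile = x}
    ⟨_, 1, single Finset.univ, rfl⟩
  exact ⟨n, D, fun k D' => hmin _ ⟨k, D', rfl⟩⟩

namespace Gluing

variable {M ι : Type*} [DecidableEq V]
  {D : G.PartialDecomposition Finset.univ N} {E : G.PartialDecomposition X M}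

/-- If the border of a part has minimum weight among the sets that separate it from a set `W` in
the bag of the root, then at least as many vertices are removed as are added. -/
theorem card_added_le (g : Gluing D E ι) {i : ι} {s : N} {W : Finset V}
    (hW : W ⊆ D.bag (g.root i)) (hWC : ∀ w ∈ W, w ∉ g.part i) {d : V → ℕ}
    (hmin : ∀ Y, G.Separates (g.border i) W Y →
      ∑ v ∈ g.border i, weight d v ≤ ∑ v ∈ Y, weight d v) :
    (g.added i s).card ≤ (g.removed i s).card ∧ ((g.added i s).card = (g.removed i s).card →
      (∀ x ∈ g.added i s, ∀ y ∈ g.removed i s, d y < d x) → g.removed i s = ∅) :=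
  card_le_of_sum_weight_sdiff_union_le (fun _ hv => (g.mem_added.1 hv).1)
    (hmin _ (g.separates_exchange i s Finset.subset_union_right hW hWC))

variable [Fintype M] [Fintype N] [Fintype ι]

/-- If the bags of `E` are small, copies of bags of `D` are not larger than the originals, and
equally large only if no vertices are exchanged, then the new decomposition has a smaller profile,
provided that all copies of some large bag are smaller than the original. -/
theorem profile_lt (g : Gluing D E ι) {k : ℕ} (hE : ∀ m, (E.bag m).card < k)
    (hle : ∀ i s, (g.added i s).card ≤ (g.removed i s).card ∧
      ((g.added i s).card = (g.removed i s).card → g.removed i s = ∅))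
    {s₀ : N} (hs₀ : k ≤ (D.bag s₀).card)
    (hlt : ∀ i, (g.bag (.inr (i, s₀))).card < (D.bag s₀).card) :
    g.decomposition.profile < D.profile := by
  classical
  have hbag : ∀ n, g.decomposition.bag n = g.bag n := fun _ => rfl
  have h1 : ∀ i s, (g.bag (.inr (i, s))).card ≤ (D.bag s).card := fun i s => by
    have := g.card_bag_inr i s
    have := (hle i s).1
    omega
  -- If one copy keeps its size, nothing is removed, so the original lies in `part i ∪ border i`.
  -- Any other copy then retains only border vertices, and these lie in a single bag of `E`.
  have h2 : ∀ i j s, (g.bag (.inr (i, s))).card = (D.bag s).card → j ≠ i →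
      (g.bag (.inr (j, s))).card < k := by
    intro i j s h hji
    have hr := (hle i s).2 (by have := g.card_bag_inr i s; omega)
    refine lt_of_le_of_lt (Finset.card_le_card fun v hv => ?_) (hE (g.anchor j))
    apply g.border_subset j
    rcases g.mem_bag_inr.1 hv with ⟨hvj, hvs⟩ | ⟨hvj, -⟩
    · exfalso
      have hvr : v ∉ g.removed i s := by simp [hr]
      have : v ∈ g.part i ∨ v ∈ g.border i := by
        by_contra hc
        push Not at hc
        exact hvr (g.mem_removed.2 ⟨hvs, hc⟩)
      rcases this with h | h
      · exact hji (g.part_unique v _ _ hvj h)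
      · exact g.notMem_of_mem_part j v hvj (g.border_subset_carrier i h)
    · exact hvj
  -- A largest bag all of whose copies shrink. New bags of at least this size project injectively to
  -- old bags of the same size, and the projection misses `s₁`.
  obtain ⟨s₁, hs₁, hmax⟩ := (Finset.univ.filter fun s => k ≤ (D.bag s).card ∧
    ∀ i, (g.bag (.inr (i, s))).card < (D.bag s).card).exists_max_image
      (fun s => (D.bag s).card) ⟨s₀, by simpa using ⟨hs₀, hlt⟩⟩
  simp only [Finset.mem_filter, Finset.mem_univ, true_and] at hs₁ hmax
  have h3 : ∀ i s, (D.bag s₁).card ≤ (g.bag (.inr (i, s))).card →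
      (g.bag (.inr (i, s))).card = (D.bag s).card := by
    intro i s hj
    by_contra hne
    have h4 := h1 i s
    obtain ⟨i', hi'⟩ : ∃ i', (g.bag (.inr (i', s))).card = (D.bag s).card := by
      by_contra! hc
      have := hmax s ⟨by omega, fun i => lt_of_le_of_ne (h1 i s) (hc i)⟩
      omega
    have := h2 i' i s hi' (by rintro rfl; exact hne hi')
    omega
  let f : M ⊕ ι × N → N := Sum.elim (fun _ => s₀) Prod.snd
  have hmaps : ∀ j, (D.bag s₁).card ≤ j → ∀ n, (g.bag n).card = j → (D.bag (f n)).card = j := by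
    rintro j hj (a | ⟨i, s⟩) hn
    · have := hE a
      simp only [bag] at hn
      omega
    · rw [← hn]
      exact (h3 i s (by omega)).symm
  have hinj : ∀ j, (D.bag s₁).card ≤ j → ∀ n, (g.bag n).card = j → ∀ n', (g.bag n').card = j →
      f n = f n' → n = n' := by
    rintro j hj (a | ⟨i, s⟩) hn (a' | ⟨i', s'⟩) hn' he
    · have := hE a
      simp only [bag] at hn
      omega
    · have := hE a
      simp only [bag] at hn
      omega
    · have := hE a'
      simp only [bag] at hn'
      omega
    · obtain rfl : s = s' := he
      by_cases hi : i = i'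
      · rw [hi]
      · have := h2 i i' s (h3 i s (by omega)) (Ne.symm hi)
        omega
  refine profile_lt_profile (j := (D.bag s₁).card) (fun j hj => ?_) ?_
  · refine Finset.card_le_card_of_injOn f (fun n hn => ?_) fun n hn n' hn' => ?_
    · simp only [Finset.coe_filter, Finset.mem_univ, true_and, Set.mem_ofPred_eq, hbag] at hn ⊢
      exact hmaps j hj n hn
    · simp only [Finset.coe_filter, Finset.mem_univ, true_and, Set.mem_ofPred_eq, hbag] at hn hn'
      exact hinj j hj n hn n' hn'
  · refine lt_of_le_of_lt (Finset.card_le_card_of_injOn (t := (Finset.univ.filter fun s =>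
      (D.bag s).card = (D.bag s₁).card).erase s₁) f (fun n hn => ?_) fun n hn n' hn' => ?_)
      (Finset.card_erase_lt_of_mem (by simp))
    · simp only [Finset.coe_filter, Finset.mem_univ, true_and, Set.mem_ofPred_eq, hbag] at hn
      simp only [Finset.coe_erase, Finset.coe_filter, Finset.mem_univ, true_and, Set.mem_sdiff,
        Set.mem_ofPred_eq, Set.mem_singleton_iff]
      refine ⟨hmaps _ le_rfl n hn, fun he => ?_⟩
      rcases n with a | ⟨i, s⟩
      · have := hE a
        simp only [bag] at hn
        omega
      · obtain rfl : s = s₁ := he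
        exact absurd hn (hs₁.2 i).ne
    · simp only [Finset.coe_filter, Finset.mem_univ, true_and, Set.mem_ofPred_eq, hbag] at hn hn'
      exact hinj _ le_rfl n hn n' hn'

end Gluing

end PartialDecomposition


/-! ### Minimum profile implies strong leanness -/

namespace PartialDecomposition

variable {V N : Type*} [Fintype V] [DecidableEq V] {G : SimpleGraph V}

/-- In a decomposition of minimum profile, no bag is covered by a partial decomposition with
smaller bags. -/
theorem not_covered_of_minimal_profile [Fintype N] (D : G.PartialDecomposition Finset.univ N)
    (hD : ∀ (k : ℕ) (D' : G.PartialDecomposition Finset.univ (Fin k)), ¬ D'.profile < D.profile)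
    (t : N) {M : Type*} [Fintype M] {X₀ : Finset V} (E₀ : G.PartialDecomposition X₀ M)
    (hX₀ : D.bag t ⊆ X₀) : ∃ m, (D.bag t).card ≤ (E₀.bag m).card := by
  classical
  by_contra! hE₀
  let d := D.distTo t
  -- The cover is chosen of minimum weight with the node type fixed, which suffices because
  -- contraction along a linkage keeps the tree.
  have hex : ∃ n, ∃ (X : Finset V) (E : G.PartialDecomposition X M), D.bag t ⊆ X ∧
      (∀ m, (E.bag m).card < (D.bag t).card) ∧ ∑ v ∈ X, weight d v = n :=
    ⟨_, X₀, E₀, hX₀, hE₀, rfl⟩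
  obtain ⟨X, E, hX, hE, hn⟩ := Nat.find_spec hex
  have hmin : ∀ (X' : Finset V) (E' : G.PartialDecomposition X' M), D.bag t ⊆ X' →
      (∀ m, (E'.bag m).card ≤ (E.bag m).card) → ∑ v ∈ X, weight d v ≤ ∑ v ∈ X', weight d v :=
    fun X' E' h h' => hn.trans_le
      (Nat.find_min' hex ⟨X', E', h, fun m => (h' m).trans_lt (hE m), rfl⟩)
  let comp : V → Finset V := fun c => Finset.univ.filter fun v => G.JoinIn (X : Set V)ᶜ c v
  have hcomp : ∀ c v, v ∈ comp c ↔ G.JoinIn (X : Set V)ᶜ c v := by simp [comp]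
  let nbr : Finset V → Finset V := fun C =>
    Finset.univ.filter fun v => v ∉ C ∧ ∃ u ∈ C, G.Adj u v
  have hnbr : ∀ C v, v ∈ nbr C ↔ v ∉ C ∧ ∃ u ∈ C, G.Adj u v := by simp [nbr]
  have hnX : ∀ c v, v ∈ nbr (comp c) → v ∈ X := by
    intro c v hv
    obtain ⟨h1, u, hu, huv⟩ := (hnbr _ _).1 hv
    by_contra hvX
    rw [hcomp] at h1 hu
    exact h1 (hu.trans (.of_adj huv hu.right_mem hvX))
  -- Two neighbours of a component are joined through it, hence lie in a common bag of `E`; the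
  -- Helly property gives one bag for all.
  have hanchor : ∀ c, ∃ m, nbr (comp c) ⊆ E.bag m := by
    refine fun c => E.exists_subset_bag _ fun u hu v hv => ?_
    obtain ⟨-, a, ha, hau⟩ := (hnbr _ _).1 hu
    obtain ⟨-, b, hb, hbv⟩ := (hnbr _ _).1 hv
    rw [hcomp] at ha hb
    obtain ⟨p, hp⟩ := ha.symm.trans hb
    refine E.torso u (hnX c u hu) v (hnX c v hv)
      (.cons hau.symm (p.append (.cons hbv .nil))) fun w hw hwX => ?_
    simp only [Walk.support_cons, List.mem_cons, Walk.mem_support_append_iff, Walk.support_nil,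
      List.not_mem_nil, or_false] at hw
    rcases hw with h | h | h | h
    · exact Or.inl h
    · exact absurd hwX (hp w h)
    · exact absurd hwX (h ▸ hb.right_mem)
    · exact Or.inr h
  choose anchor hanchor using hanchor
  -- The index is the component itself rather than a representative, since parts with different
  -- indices must be disjoint.
  let g : Gluing D E {C : Finset V // ∃ c ∉ X, C = comp c} :=
    { part := Subtype.val
      border := fun C => nbr C
      anchor := fun C => anchor C.2.choose
      root := fun _ => t
      notMem_of_mem_part := by
        intro C v hv
        obtain ⟨c, -, hC⟩ := C.2
        rw [hC] at hv
        exact ((hcomp c v).1 hv).right_mem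
      exists_part := fun v hv => ⟨⟨comp v, v, hv, rfl⟩, (hcomp v v).2 (.refl hv)⟩
      part_unique := by
        intro v C C' h h'
        obtain ⟨c, -, hC⟩ := C.2
        obtain ⟨c', -, hC'⟩ := C'.2
        rw [hC, hcomp] at h
        rw [hC', hcomp] at h'
        refine Subtype.ext ?_
        have : comp c = comp c' := by
          ext w
          simp only [hcomp]
          exact ⟨fun hw => h'.trans (h.symm.trans hw), fun hw => h.trans (h'.symm.trans hw)⟩
        rw [hC, hC', this]
      adj_part := fun C u v hu huv => by
        by_cases hv : v ∈ C.1
        · exact Or.inl hv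
        · exact Or.inr ((hnbr _ _).2 ⟨hv, u, hu, huv⟩)
      border_subset := fun C => by
        have := hanchor C.2.choose
        rwa [← C.2.choose_spec.2] at this }
  have hWC : ∀ C, ∀ w ∈ D.bag t, w ∉ g.part C := fun C w hw hwC =>
    g.notMem_of_mem_part C w hwC (hX hw)
  have hlt := g.profile_lt hE (fun C s => ?_) le_rfl (s₀ := t) fun C => ?_
  · refine hD _ (g.decomposition.reindex (Fintype.equivFin _).symm) ?_
    rwa [profile_reindex]
  · have h := g.card_added_le (i := C) (s := s) (subset_refl _) (hWC C) (d := d)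
      fun Y hY => E.sum_weight_le_of_separates hX d hmin (g.border_subset C) hY
    refine ⟨h.1, fun he => h.2 he fun x hx y hy => ?_⟩
    obtain ⟨-, hb, hxs⟩ := g.mem_added.1 hx
    exact (D.distTo_le (g.mem_removed.1 hy).1).trans_lt (hb.dist_lt (Finset.mem_univ _) hxs)
  -- As `D.bag t ⊆ X`, the copies of `t` contain border vertices only.
  · refine lt_of_le_of_lt (Finset.card_le_card fun v hv => ?_) (hE (g.anchor C))
    rcases g.mem_bag_inr.1 hv with ⟨h1, h2⟩ | ⟨h1, -⟩
    · exact absurd h1 (hWC C v h2)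
    · exact g.border_subset C h1

/-- Two sets of `k` vertices in bags at distance `ℓ` violate leanness. -/
def LeanViolation (D : G.PartialDecomposition Finset.univ N) (k ℓ : ℕ) : Prop :=
  ∃ (t₁ t₂ : N) (Z₁ Z₂ : Finset V) (p : D.tree.Walk t₁ t₂), p.IsPath ∧ p.length = ℓ ∧
    Z₁ ⊆ D.bag t₁ ∧ Z₂ ⊆ D.bag t₂ ∧ Z₁.card = k ∧ Z₂.card = k ∧
    (∃ S, G.Separates Z₁ Z₂ S ∧ S.card < k) ∧
    ∀ x y, s(x, y) ∈ p.edges → k ≤ (D.bag x ∩ D.bag y).card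

/-- Unless `s = t₁`, the path enters `s` by an edge, whose adhesion set lies in the bag of `s`. -/
theorem le_card_bag_of_mem_support (D : G.PartialDecomposition Finset.univ N) {k : ℕ} {t₁ t₂ : N}
    {p : D.tree.Walk t₁ t₂} (hp : ∀ x y, s(x, y) ∈ p.edges → k ≤ (D.bag x ∩ D.bag y).card)
    (h₁ : k ≤ (D.bag t₁).card) {s : N} (hs : s ∈ p.support) : k ≤ (D.bag s).card := by
  classical
  by_cases hst : t₁ = s
  · exact hst ▸ h₁
  obtain ⟨e, he, -, he'⟩ := (p.takeUntil s hs).exists_boundary_dart {s}ᶜ hst (by simp)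
  have he' : e.snd = s := by simpa using he'
  refine (hp e.fst s ?_).trans (Finset.card_le_card Finset.inter_subset_right)
  rw [← he']
  exact List.mem_map_of_mem (f := Dart.edge) (p.darts_takeUntil_subset_darts hs he)

/-- The exchange of vertices in the copies attached at one end of a shortest violation of
leanness. -/
theorem Gluing.card_added_le_of_shortest {M ι : Type*} {X : Finset V}
    {D : G.PartialDecomposition Finset.univ N} {E : G.PartialDecomposition X M}
    (g : Gluing D E ι) {k : ℕ} {t₁ t₂ : N} {Z₁ Z₂ : Finset V} {p : D.tree.Walk t₁ t₂}
    (hp : p.IsPath) (hZ₁ : Z₁ ⊆ D.bag t₁) (hZ₂ : Z₂ ⊆ D.bag t₂) (hk₁ : Z₁.card = k)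
    (hk₂ : Z₂.card = k) (hadh : ∀ x y, s(x, y) ∈ p.edges → k ≤ (D.bag x ∩ D.bag y).card)
    (hshort : ∀ ℓ < p.length, ¬ D.LeanViolation k ℓ) {i : ι} (hroot : g.root i = t₂)
    (hcard : (g.border i).card < k) (hpart : ∀ z ∈ Z₂, z ∉ g.part i) {d : V → ℕ}
    (hd : ∀ v, d v = D.distTo t₁ v + D.distTo t₂ v)
    (hmin : ∀ Y, G.Separates (g.border i) Z₂ Y →
      ∑ v ∈ g.border i, weight d v ≤ ∑ v ∈ Y, weight d v) (s : N) :
    (g.added i s).card ≤ (g.removed i s).card ∧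
      ((g.added i s).card = (g.removed i s).card → g.removed i s = ∅) := by
  classical
  subst hroot
  have h := g.card_added_le (i := i) (s := s) hZ₂ hpart hmin
  refine ⟨h.1, fun he => ?_⟩
  -- On the path beyond `t₁`, an exchange of equally many vertices would leave a set of fewer than
  -- `k` vertices separating `k` vertices in the bag of `s` from `Z₂`: a shorter violation.
  -- Elsewhere, removed vertices are strictly nearer to the root and no farther from `t₁` than added
  -- ones.
  by_cases hs : s ∈ p.support ∧ s ≠ t₁
  · exfalso
    obtain ⟨Z, hZ, hZk⟩ := Finset.exists_subset_card_eq
      (D.le_card_bag_of_mem_support hadh (hk₁ ▸ Finset.card_le_card hZ₁) hs.1)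
    refine hshort _ (p.length_dropUntil_lt_length hs.1 hs.2) ⟨s, _, Z, Z₂, p.dropUntil s hs.1,
      hp.dropUntil hs.1, rfl, hZ, hZ₂, hZk, hk₂, ⟨(g.border i \ g.added i s) ∪ g.removed i s,
        fun a ha w hw haw => ?_, ?_⟩, fun x y hxy =>
          hadh x y (p.edges_dropUntil_subset_edges hs.1 hxy)⟩
    · by_cases har : a ∈ g.removed i s
      · exact haw.left_mem (by simp [har])
      · refine g.separates_exchange i s (A := {a}) ?_ hZ₂ hpart a (by simp) w hw haw
        rw [g.mem_removed] at har
        rw [Finset.singleton_subset_iff, Finset.mem_union]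
        by_contra hc
        push Not at hc
        exact har ⟨hZ ha, hc⟩
    · refine (Finset.card_union_le _ _).trans_lt ?_
      have hsub : g.added i s ⊆ g.border i := fun v hv => (g.mem_added.1 hv).1
      have := Finset.card_sdiff_add_card_eq_card hsub
      omega
  · refine h.2 he fun x hx y hy => ?_
    obtain ⟨-, hb, hxs⟩ := g.mem_added.1 hx
    have hys := (g.mem_removed.1 hy).1
    have h2 := (D.distTo_le (r := g.root i) hys).trans_lt (hb.dist_lt (Finset.mem_univ _) hxs)
    have h1 : D.distTo t₁ y ≤ D.distTo t₁ x := by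
      refine (D.distTo_le hys).trans ?_
      by_cases hst : s = t₁
      · simp [hst]
      · refine (Between.dist_lt (fun m hm q => ?_) (Finset.mem_univ x) hxs).le
        -- A walk to `t₁` continued along `p` ends at the root and so passes through `s`, which is
        -- not on `p`.
        have := hb m hm (q.append p)
        rw [Walk.mem_support_append_iff] at this
        exact this.resolve_right fun h' => hs ⟨h', hst⟩
    rw [hd, hd]
    omega

/-- A decomposition of minimum profile is lean. -/
theorem not_leanViolation_of_minimal_profile [Fintype N]
    (D : G.PartialDecomposition Finset.univ N)
    (hD : ∀ (k : ℕ) (D' : G.PartialDecomposition Finset.univ (Fin k)), ¬ D'.profile < D.profile)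
    (k ℓ : ℕ) : ¬ D.LeanViolation k ℓ := by
  classical
  induction ℓ using Nat.strong_induction_on with
  | h ℓ hshort =>
  rintro ⟨t₁, t₂, Z₁, Z₂, p, hp, rfl, hZ₁, hZ₂, hk₁, hk₂, ⟨S₀, hS₀, hS₀k⟩, hadh⟩
  let d : V → ℕ := fun v => D.distTo t₁ v + D.distTo t₂ v
  obtain ⟨S, hS, hSmin⟩ := Set.exists_min_image {S | G.Separates Z₁ Z₂ S}
    (fun S => ∑ v ∈ S, weight d v) (Set.toFinite _) ⟨S₀, hS₀⟩
  have hS : G.Separates Z₁ Z₂ S := hS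
  have hSk : S.card < k := (card_le_of_sum_weight_le (hSmin S₀ hS₀)).trans_lt hS₀k
  let R : Set V := {v | ∃ z ∈ Z₁, G.JoinIn (S : Set V)ᶜ z v}
  have hRS : ∀ v ∈ R, v ∉ S := fun v ⟨z, _, h⟩ => h.right_mem
  have hRadj : ∀ u v, u ∈ R → v ∉ S → G.Adj u v → v ∈ R := fun u v ⟨z, hz, h⟩ hv huv =>
    ⟨z, hz, h.trans (.of_adj huv h.right_mem hv)⟩
  let E : G.PartialDecomposition S Unit := single S
  let part : Bool → Finset V := fun b => Finset.univ.filter fun v => v ∉ S ∧ (v ∈ R ↔ b = true)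
  have hpart : ∀ b v, v ∈ part b ↔ v ∉ S ∧ (v ∈ R ↔ b = true) := by simp [part]
  let g : Gluing D E Bool :=
    { part := part
      border := fun _ => S
      anchor := fun _ => ()
      -- The side of `Z₁` is attached at `t₂` and the other side at `t₁`: the set to be separated
      -- from the border lies in the bag of the root, outside the part.
      root := fun b => if b then t₂ else t₁
      notMem_of_mem_part := fun b v hv => ((hpart b v).1 hv).1
      exists_part := fun v hv => ⟨decide (v ∈ R), (hpart _ v).2 ⟨hv, by simp⟩⟩
      part_unique := fun v b c h h' => by
        rw [hpart] at h h'
        exact Bool.eq_iff_iff.2 (h.2.symm.trans h'.2)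
      adj_part := fun b u v hu huv => by
        rw [hpart] at hu
        by_cases hv : v ∈ S
        · exact Or.inr hv
        · refine Or.inl ((hpart b v).2 ⟨hv, Iff.trans ?_ hu.2⟩)
          exact ⟨fun h => hRadj v u h hu.1 huv.symm, fun h => hRadj u v h hv huv⟩
      border_subset := fun _ => subset_rfl }
  have hgpart : ∀ b v, v ∈ g.part b ↔ v ∉ S ∧ (v ∈ R ↔ b = true) := hpart
  have hZ₂part : ∀ z ∈ Z₂, z ∉ g.part true := by
    intro z hz hzp
    obtain ⟨a, ha, h⟩ := ((hgpart _ _).1 hzp).2.2 rfl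
    exact hS a ha z hz h
  have hZ₁part : ∀ z ∈ Z₁, z ∉ g.part false := by
    intro z hz hzp
    have h := (hgpart _ _).1 hzp
    simpa using h.2.1 ⟨z, hz, .refl h.1⟩
  -- Every walk from `Z₁` to `Z₂` meets `S`, so what separates `S` from one of the two sets
  -- separates them from each other.
  have hmin₂ : ∀ Y, G.Separates S Z₂ Y → ∑ v ∈ S, weight d v ≤ ∑ v ∈ Y, weight d v :=
    fun Y hY => hSmin Y fun a ha b hb hab => by
      obtain ⟨s, hs, h⟩ := hab.symm.exists_mem (hS.symm b hb a ha)
      exact hY s hs b hb h.symm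
  have hmin₁ : ∀ Y, G.Separates S Z₁ Y → ∑ v ∈ S, weight d v ≤ ∑ v ∈ Y, weight d v :=
    fun Y hY => hSmin Y fun a ha b hb hab => by
      obtain ⟨s, hs, h⟩ := hab.exists_mem (hS a ha b hb)
      exact hY s hs a ha h.symm
  have hex : ∀ b s, (g.added b s).card ≤ (g.removed b s).card ∧
      ((g.added b s).card = (g.removed b s).card → g.removed b s = ∅) := by
    rintro (_ | _) s
    · refine g.card_added_le_of_shortest hp.reverse hZ₂ hZ₁ hk₂ hk₁ (fun x y hxy => ?_) ?_ rfl hSk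
        hZ₁part (d := d) (fun v => Nat.add_comm _ _) hmin₁ s
      · exact hadh x y (by simpa using hxy)
      · simpa using hshort
    · exact g.card_added_le_of_shortest hp hZ₁ hZ₂ hk₁ hk₂ hadh hshort rfl hSk hZ₂part
        (d := d) (fun v => rfl) hmin₂ s
  -- Otherwise every bag on the path lies, up to `S`, on one side. As `Z₁` and `Z₂` do not fit into
  -- `S`, the side changes at some edge of the path, or at the node itself if the path is trivial;
  -- the adhesion set of that edge lies in `S` and is too small.
  obtain ⟨s₀, hs₀, hlt⟩ : ∃ s ∈ p.support, ∀ b, (g.bag (.inr (b, s))).card < (D.bag s).card := by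
    by_contra! hc
    have hside : ∀ s ∈ p.support, ∃ b, ∀ v ∈ D.bag s, v ∈ g.part b ∨ v ∈ S := by
      intro s hs
      obtain ⟨b, hb⟩ := hc s hs
      have h1 := g.card_bag_inr b s
      have h2 := hex b s
      have h3 := h2.2 (by omega)
      refine ⟨b, fun v hv => ?_⟩
      by_contra hc
      push Not at hc
      have : v ∈ g.removed b s := g.mem_removed.2 ⟨hv, hc⟩
      simp [h3] at this
    have hcardS : ∀ Z : Finset V, Z.card = k → ¬ Z ⊆ S := fun Z hZ h => by
      have := Finset.card_le_card h
      omega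
    let A : Set N := {s | ∀ v ∈ D.bag s, v ∈ g.part true ∨ v ∈ S}
    obtain ⟨e, he, heA, heA'⟩ := p.exists_boundary_dart A (by
      obtain ⟨_ | _, hb⟩ := hside t₁ p.start_mem_support
      · exact absurd (fun z hz => (hb z (hZ₁ hz)).resolve_left (hZ₁part z hz)) (hcardS Z₁ hk₁)
      · exact hb) fun hb =>
        hcardS Z₂ hk₂ fun z hz => (hb z (hZ₂ hz)).resolve_left (hZ₂part z hz)
    obtain ⟨b, hb⟩ := hside e.snd (p.dart_snd_mem_support_of_mem_darts he)
    have hbf : b = false := by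
      cases b
      · rfl
      · exact absurd hb heA'
    subst hbf
    have h1 := hadh e.fst e.snd (List.mem_map_of_mem (f := Dart.edge) he)
    have h2 : D.bag e.fst ∩ D.bag e.snd ⊆ S := by
      intro v hv
      rw [Finset.mem_inter] at hv
      rcases heA v hv.1 with h | h
      · rcases hb v hv.2 with h' | h'
        · exact absurd (g.part_unique v _ _ h h') (by simp)
        · exact h'
      · exact h
    have := Finset.card_le_card h2
    omega
  refine hD _ (g.decomposition.reindex (Fintype.equivFin _).symm) ?_
  rw [profile_reindex]
  exact g.profile_lt (fun _ => hSk) hex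
    (D.le_card_bag_of_mem_support hadh (hk₁ ▸ Finset.card_le_card hZ₁) hs₀) hlt

/-! ### Translation to and from tree decompositions -/

/-- A decomposition of the whole graph as a tree decomposition. -/
def toTreeDecomposition (D : G.PartialDecomposition Finset.univ N) : G.TreeDecomposition N where
  tree := D.tree
  isTree := D.isTree
  bag := D.bag
  vertex_condition v := D.exists_mem_bag (Finset.mem_univ v)
  edge_condition u v h := D.torso u (Finset.mem_univ _) v (Finset.mem_univ _)
    (.cons h .nil) (by simp)
  connectedness_condition v := connected_induce_iff_joinIn.2
    ⟨D.exists_mem_bag (Finset.mem_univ v), fun m hm m' hm' => D.joinIn v m m' hm hm'⟩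

end PartialDecomposition

/-- A torso tree decomposition as a partial decomposition. -/
def TorsoTreeDecomposition.toPartialDecomposition {V M : Type*} {G : SimpleGraph V}
    (E : G.TorsoTreeDecomposition M) : G.PartialDecomposition E.carrier M where
  tree := E.decomposition.tree
  isTree := E.decomposition.isTree
  bag m := (E.decomposition.bag m).map (Function.Embedding.subtype _)
  bag_subset m v hv := by
    obtain ⟨x, -, rfl⟩ := Finset.mem_map.1 hv
    exact x.2
  joinIn v m m' hm hm' := by
    obtain ⟨x, hx, rfl⟩ := Finset.mem_map.1 hm
    have key : ∀ n, (x : V) ∈ (E.decomposition.bag n).map (Function.Embedding.subtype _) ↔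
        x ∈ E.decomposition.bag n := fun n => Finset.mem_map' (Function.Embedding.subtype _)
    refine ((connected_induce_iff_joinIn.1 (E.decomposition.connectedness_condition x)).2 m hx m'
      ((key m').1 hm')).mono fun n hn => (key n).2 hn
  torso u hu v hv p hp := by
    classical
    obtain ⟨m, h1, h2⟩ : ∃ m, (⟨u, hu⟩ : E.carrier) ∈ E.decomposition.bag m ∧
        (⟨v, hv⟩ : E.carrier) ∈ E.decomposition.bag m := by
      by_cases huv : u = v
      · subst huv
        obtain ⟨m, hm⟩ := E.decomposition.vertex_condition ⟨u, hu⟩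
        exact ⟨m, hm, hm⟩
      · refine E.decomposition.edge_condition _ _
          ⟨fun h => huv (congrArg Subtype.val h), p.toPath, fun w hw hwu hwv hwX => ?_⟩
        rcases hp w (p.support_bypass_subset_support hw) hwX with h | h
        exacts [hwu h, hwv h]
    exact ⟨m, Finset.mem_map_of_mem _ h1, Finset.mem_map_of_mem _ h2⟩

theorem Walk.adj_of_forall_mem_support {V : Type*} {G : SimpleGraph V} {u v : V} (p : G.Walk u v)
    (huv : u ≠ v) (hp : ∀ w ∈ p.support, w = u ∨ w = v) : G.Adj u v := by
  cases p with
  | nil => exact absurd rfl huv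
  | cons hadj q =>
    rcases hp _ (List.mem_cons_of_mem _ q.start_mem_support) with h | h
    · exact absurd (h ▸ hadj) G.irrefl
    · exact h ▸ hadj

/-- A tree decomposition of `G` as a torso tree decomposition that covers everything. -/
def TreeDecomposition.toTorsoTreeDecomposition {V M : Type*} [Fintype V] {G : SimpleGraph V}
    (E : G.TreeDecomposition M) : G.TorsoTreeDecomposition M where
  carrier := Finset.univ
  decomposition :=
    { tree := E.tree
      isTree := E.isTree
      bag := fun m => (E.bag m).map ⟨fun v => ⟨v, Finset.mem_univ v⟩, fun u v h => by simpa using h⟩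
      vertex_condition := fun v => by
        obtain ⟨m, hm⟩ := E.vertex_condition v
        exact ⟨m, Finset.mem_map.2 ⟨v, hm, rfl⟩⟩
      edge_condition := fun u v h => by
        obtain ⟨hne, p, hp⟩ := h
        obtain ⟨m, h1, h2⟩ := E.edge_condition u v
          (p.1.adj_of_forall_mem_support (fun h => hne (Subtype.ext h)) fun w hw => by
            by_contra! hc
            exact hp w hw hc.1 hc.2 (Finset.mem_univ w))
        exact ⟨m, Finset.mem_map.2 ⟨u, h1, rfl⟩, Finset.mem_map.2 ⟨v, h2, rfl⟩⟩
      connectedness_condition := fun v => by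
        obtain ⟨⟨m, hm⟩, hj⟩ := connected_induce_iff_joinIn.1 (E.connectedness_condition v)
        have key : ∀ n, v ∈ (E.bag n).map ⟨fun v => (⟨v, Finset.mem_univ v⟩ :
            (Finset.univ : Finset V)), fun u v h => by simpa using h⟩ ↔ (v : V) ∈ E.bag n :=
          fun n => Finset.mem_map' (a := (v : V)) _
        exact connected_induce_iff_joinIn.2 ⟨⟨m, (key m).2 hm⟩, fun a ha b hb =>
          (hj a ((key a).1 ha) b ((key b).1 hb)).mono fun n hn => (key n).2 hn⟩ }

end SimpleGraph

theorem mainTheorem9 {V : Type*} [Fintype V] [DecidableEq V] (G : SimpleGraph V) :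
    (∃ (N : Type) (_ : Fintype N) (D : G.TreeDecomposition N), D.IsStronglyLeanDecomposition) ∧
      ∀ (N : Type) [Fintype N] (D : G.TreeDecomposition N), D.IsStronglyLeanDecomposition →
        ∀ (M : Type) [Fintype M] (E : G.TreeDecomposition M), D.width ≤ E.width := by
  constructor
  · obtain ⟨n, D, hD⟩ := SimpleGraph.PartialDecomposition.exists_minimal_profile G
    refine ⟨Fin n, inferInstance, D.toTreeDecomposition, ?_, ?_⟩
    · intro t₁ t₂ Z₁ Z₂ hZ₁ hZ₂ hcard
      by_contra! hc
      obtain ⟨hlink, hadh⟩ := hc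
      obtain ⟨p⟩ := D.isTree.connected.preconnected t₁ t₂
      refine D.not_leanViolation_of_minimal_profile hD Z₁.card _ ⟨t₁, t₂, Z₁, Z₂, p.bypass,
        p.bypass_isPath, rfl, hZ₁, hZ₂, rfl, hcard.symm, ?_, hadh ⟨p.bypass, p.bypass_isPath⟩⟩
      by_contra! hc
      exact hlink (SimpleGraph.isLinkedInto_of_forall_separates hc)
    · rintro t ⟨M, _, E, hE, hw⟩
      obtain ⟨m, hm⟩ := D.not_covered_of_minimal_profile hD t E.toPartialDecomposition hE
      have h1 : ((E.decomposition.bag m).card : ℤ) ≤ E.width + 1 := by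
        unfold SimpleGraph.TorsoTreeDecomposition.width SimpleGraph.TreeDecomposition.width
        rw [sub_add_cancel, Nat.cast_le]
        exact Finset.le_sup (f := fun t => (E.decomposition.bag t).card) (Finset.mem_univ m)
      have h2 : (E.toPartialDecomposition.bag m).card = (E.decomposition.bag m).card :=
        Finset.card_map _
      have h3 : ((D.bag t).card : ℤ) ≤ (E.decomposition.bag m).card := by
        rw [← h2]
        exact_mod_cast hm
      have h4 : E.width ≤ ((D.bag t).card : ℤ) - 2 := hw
      omega
  · intro N _ D hD M _ E
    by_contra! hlt
    have : Nonempty N := D.isTree.connected.nonempty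
    -- A largest bag of `D`: a decomposition of smaller width would be a torso tree decomposition
    -- covering it that is too narrow.
    obtain ⟨t, -, ht⟩ := Finset.exists_mem_eq_sup (Finset.univ : Finset N) Finset.univ_nonempty
      fun t => (D.bag t).card
    refine hD.2 t ⟨M, inferInstance, E.toTorsoTreeDecomposition, Finset.subset_univ _, ?_⟩
    have h1 : E.toTorsoTreeDecomposition.width = E.width := by
      unfold SimpleGraph.TorsoTreeDecomposition.width SimpleGraph.TreeDecomposition.width
        SimpleGraph.TreeDecomposition.toTorsoTreeDecomposition
      simp only [Finset.card_map]
    have h2 : D.width = ((D.bag t).card : ℤ) - 1 := by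
      unfold SimpleGraph.TreeDecomposition.width
      rw [ht]
    omega
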